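/- Let $P$ be a convex polygon with vertices $0,1,\dots,n-1$ in cyclic order, $n=w+3$. A dissection $D$ of $P$ is a set of pairwise non-crossing diagonals; it splits $P$ into subpolygons, and it is a $p$-angulation if all of them are $p$-gons (a triangulation if $p=3$). Put $\lambda_p=2\cos(\pi/p)$. A frieze pattern of width $w$ consists of infinite rows of real numbers, numbered $0$ to $w+3$ from below, with an offset between even and odd rows, such that rows $0$ and $w+3$ consist of zeros, rows $1$ and $w+2$ of ones, rows $2,\dots,w+1$ of positive numbers, and $ad-bc=1$ for every diamond with left, right, top and bottom entries $a,d,b,c$. The frieze of a dissection $D$ is the frieze pattern of width $w$ whose row number $2$ repeats with period $n$ the numbers $\sum_{P_j\ni\alpha}\lambda_{p_j}$ ($\alpha=0,\dots,n-1$), the sum being over the subpolygons $P_j$ of $D$ incident with $\alpha$, where $P_j$ is a $p_j$-gon. If $D$ is a $p$-angulation, this is the (Holm–Jørgensen) frieze of type $\Lambda_p$ attached to $D$; if $D$ is a triangulation, it is its Conway–Coxeter frieze. Index the entries of the frieze as $F_{k,i}$ ($0\le k\le w+3$, $i\in\mathbb Z$), so that $F_{2,i}$ belongs to the vertex $i \bmod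 n$, and $F_{k+2,i}$ and $F_{k,i+1}$ are the top and the bottom of the diamond with left entry $F_{k+1,i}$ and right entry $F_{k+1,i+1}$. **Theorem.** Let $(p,m)=(4,2)$ or $(p,m)=(6,3)$, and let $D$ be a $p$-angulation of $P$. Then the frieze $F$ of type $\Lambda_p$ attached to $D$ exists, and for each parity class $c\in\mathbb Z/2$ there is a unique triangulation $T_D$ of $P$ with a Conway–Coxeter frieze $G$ such that: 1. $F$ and $G$ coincide in every odd-numbered row; 2. for every even $k$ with $2\le k\le w+1$ and every $i\in\mathbb Z$ there is a positive integer $a$ such that $F_{k,i}=\sqrt m\,a$, and $G_{k,i}=a$ if $i\equiv c \pmod 2$, while $G_{k,i}=m\,a$ if $i\not\equiv c\pmod 2$. Moreover, every triangulation whose Conway–Coxeter frieze coincides with $F$ in every odd-numbered row satisfies condition 2 for some $c$. So, up to the choice of $c$ (that is, of one of the two alternating colourings of the vertices of $P$), $T_D$ is uniquely determined by condition 1. -/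

import Mathlib

/-- A diagonal of the convex polygon with vertices `0, 1, …, n - 1` (in cyclic order), written as
the pair of its endpoints, the smaller one first: the endpoints are distinct and not adjacent. -/
def IsDiagonal {n : ℕ} (d : Fin n × Fin n) : Prop :=
  d.1.val + 1 < d.2.val ∧ ¬ (d.1.val = 0 ∧ d.2.val + 1 = n)

/-- The diagonals `d` and `e` cross, `d` having the smaller first endpoint. -/
def Crosses {n : ℕ} (d e : Fin n × Fin n) : Prop :=
  d.1 < e.1 ∧ e.1 < d.2 ∧ d.2 < e.2

/-- A polygon dissection: a set of pairwise non-crossing diagonals of the `n`-gon. -/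
def IsDissection {n : ℕ} (D : Finset (Fin n × Fin n)) : Prop :=
  (∀ d ∈ D, IsDiagonal d) ∧ ∀ d ∈ D, ∀ e ∈ D, ¬ Crosses d e

/-- All the vertices in `S` lie on one (closed) side of the diagonal `d`. -/
def OnOneSide {n : ℕ} (d : Fin n × Fin n) (S : Finset (Fin n)) : Prop :=
  (∀ x ∈ S, d.1 ≤ x ∧ x ≤ d.2) ∨ (∀ x ∈ S, x ≤ d.1 ∨ d.2 ≤ x)

/-- `S` is the vertex set of one of the subpolygons into which the dissection `D` splits the
polygon: a maximal set of at least three vertices that no diagonal of `D` separates. -/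
def IsSubpolygon {n : ℕ} (D : Finset (Fin n × Fin n)) (S : Finset (Fin n)) : Prop :=
  Maximal (fun S : Finset (Fin n) => 3 ≤ S.card ∧ ∀ d ∈ D, OnOneSide d S) S

open Classical in
/-- The (vertex sets of the) subpolygons into which `D` splits the `n`-gon. -/
noncomputable def subpolygons {n : ℕ} (D : Finset (Fin n × Fin n)) : Finset (Finset (Fin n)) :=
  Finset.univ.filter (IsSubpolygon D)

/-- A `p`-angulation: a dissection into `p`-gons. -/
def IsAngulation {n : ℕ} (p : ℕ) (D : Finset (Fin n × Fin n)) : Prop :=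
  IsDissection D ∧ ∀ S ∈ subpolygons D, S.card = p

/-- A triangulation is a `3`-angulation. -/
def IsTriangulation {n : ℕ} (D : Finset (Fin n × Fin n)) : Prop :=
  IsAngulation 3 D

/-- `λ_p = 2 cos (π / p)`. -/
noncomputable def lam (p : ℕ) : ℝ := 2 * Real.cos (Real.pi / p)

/-- The number attached to the vertex `α` by the dissection `D`: the sum of `λ_{p_i}` over the
subpolygons `P_i` incident with `α`, where `P_i` is a `p_i`-gon. Since `λ_3 = 1`, for a
triangulation this is the number of triangles at `α`. -/
noncomputable def quiddity {n : ℕ} (D : Finset (Fin n × Fin n)) (α : Fin n) : ℝ :=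
  ∑ S ∈ (subpolygons D).filter (fun S => α ∈ S), lam S.card

/-- `F` is a frieze pattern of width `w`. `F k i` is the `i`-th entry of row number `k`, for
`0 ≤ k ≤ w + 3`; rows are counted from below, and `F (k + 2) i` (on top) and `F k (i + 1)`
(at the bottom) lie between `F (k + 1) i` and `F (k + 1) (i + 1)`. The values of `F` in rows
beyond `w + 3` are irrelevant. -/
structure IsFrieze (w : ℕ) (F : ℕ → ℤ → ℝ) : Prop where
  row_zero : ∀ i, F 0 i = 0
  row_one : ∀ i, F 1 i = 1
  row_top_one : ∀ i, F (w + 2) i = 1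
  row_top_zero : ∀ i, F (w + 3) i = 0
  pos : ∀ k, 2 ≤ k → k ≤ w + 1 → ∀ i, 0 < F k i
  diamond : ∀ k, k ≤ w + 1 → ∀ i,
    F (k + 1) i * F (k + 1) (i + 1) - F (k + 2) i * F k (i + 1) = 1

/-- `F` is the frieze pattern of the dissection `D` of the `(w + 3)`-gon: its width is `w`, and its
quiddity row (row number 2) repeats the numbers attached by `D` to the vertices
`0, 1, …, w + 2`, starting at position `0`. For a triangulation this is the Conway-Coxeter frieze,
for a `p`-angulation the Holm-Jørgensen frieze of type `Λ_p`. -/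
def IsFriezeOf {w : ℕ} (D : Finset (Fin (w + 3) × Fin (w + 3))) (F : ℕ → ℤ → ℝ) : Prop :=
  IsFrieze w F ∧
    ∀ (α : Fin (w + 3)) (r : ℤ), F 2 ((α.val : ℤ) + r * ((w : ℤ) + 3)) = quiddity D α

/-- The friezes `F` and `G` of width `w` coincide in every odd row. -/
def CoincideInOddRows (w : ℕ) (F G : ℕ → ℤ → ℝ) : Prop :=
  ∀ k, k ≤ w + 3 → Odd k → ∀ i, F k i = G k i

/-- In every non-trivial even row the entries of `F` are `√m` times positive integers `a`, and the
entry of `G` at the same place is `a` at the positions congruent to `c` modulo `2`, and `m * a` at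
the other positions. -/
def EvenRowsRelated (w m : ℕ) (c : ℤ) (F G : ℕ → ℤ → ℝ) : Prop :=
  ∀ k, 2 ≤ k → k ≤ w + 1 → Even k → ∀ i : ℤ, ∃ a : ℕ, 0 < a ∧
    F k i = Real.sqrt m * a ∧
    (i ≡ c [ZMOD 2] → G k i = a) ∧ (¬ i ≡ c [ZMOD 2] → G k i = m * a)

/-! A `p`-angulation arises from a single edge by repeatedly gluing `p`-gons along outer edges
(`glued_of_dissection`). Since `p` is even, an alternating colouring of the polygon alternates on
each `p`-gon. Cut every square by the diagonal joining its two vertices outside the class `c`, and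
every hexagon by the triangle on its three vertices outside `c`. In each cell a vertex of class `c`
then meets 1 triangle and any other vertex meets `m`. So if `q x` counts the `p`-gons at `x`, the
refined triangulation has quiddity `q` on the class `c` and `m * q` off it (`Glued.triangulates`),
while `D` has quiddity `√m * q` because `λ_p = √m`.

For even `n`, multiplying the even rows alternately by `√m` and `1 / √m` preserves the diamond rule
(`IsFrieze.rescale`). This turns the frieze of the triangulation into that of `D` and leaves the odd
rows alone. The divisibility by `m` in condition 2 comes from a linear recursion
(`dvd_sequenceFrieze`).

Conway–Coxeter friezes are obtained as determinants of integral plane vectors at the vertices, the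
tip of a glued triangle receiving the sum of the vectors of its two neighbours
(`Glued.exists_isLabelling`). Between vertices that are not adjacent in the polygon the determinant
is 1 exactly along the diagonals of the triangulation, so the quiddity determines the triangulation
(`IsTriangulation.eq_of_quiddity`).

For the last claim, row 3 fixes the products of neighbours in row 2, so the second rows of `F` and
`G` are proportional with factors alternately `r` and `1 / r` (`IsFrieze.row_two_alternates`). An
ear of the given triangulation, compared with an ear of the refinement for the same parity class,
forces the factor `1 / √m` on that class; hence the triangulation is that refinement. -/

/-! ### Dissections as iterated gluings. -/

/-- `u < v` are neighbouring elements of the vertex set `V`. -/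
def Consec {n : ℕ} (V : Finset (Fin n)) (u v : Fin n) : Prop :=
  u ∈ V ∧ v ∈ V ∧ u < v ∧ ∀ x ∈ V, x ≤ u ∨ v ≤ x

/-- A vertex set of at least three elements of `V` that is not separated by `D`. -/
def Unseparated {n : ℕ} (V : Finset (Fin n)) (D : Finset (Fin n × Fin n)) (S : Finset (Fin n)) :
    Prop :=
  3 ≤ S.card ∧ S ⊆ V ∧ ∀ d ∈ D, OnOneSide d S

open Classical in
/-- The subpolygons into which `D` splits the polygon with vertex set `V`. -/
noncomputable def subpolygonsOn {n : ℕ} (V : Finset (Fin n)) (D : Finset (Fin n × Fin n)) :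
    Finset (Finset (Fin n)) :=
  Finset.univ.filter (Maximal (Unseparated V D))

/-- The number of subpolygons incident with a vertex. -/
noncomputable def incidence {n : ℕ} (V : Finset (Fin n)) (D : Finset (Fin n × Fin n))
    (x : Fin n) : ℕ :=
  ((subpolygonsOn V D).filter (fun S => x ∈ S)).card

lemma mem_subpolygonsOn {n : ℕ} {V : Finset (Fin n)} {D : Finset (Fin n × Fin n)}
    {S : Finset (Fin n)} : S ∈ subpolygonsOn V D ↔ Maximal (Unseparated V D) S := by
  simp [subpolygonsOn]

/-- Gluing a polygon with vertices `u`, `v` and `X` along an outer edge `u v` adds one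
subpolygon. -/
lemma subpolygonsOn_glue {n : ℕ} {V X : Finset (Fin n)} {D : Finset (Fin n × Fin n)}
    {u v : Fin n} (hD : ∀ d ∈ D, d.1 ∈ V ∧ d.2 ∈ V) (huv : Consec V u v)
    (hX : ∀ x ∈ X, u < x ∧ x < v) (hne : X.Nonempty) :
    subpolygonsOn (V ∪ X) (insert (u, v) D) =
      insert (insert u (insert v X)) (subpolygonsOn V D) := by
  obtain ⟨hu, hv, hlt, hcon⟩ := huv
  obtain ⟨x₀, hx₀⟩ := hne
  have hx₀' := hX x₀ hx₀
  have hE : Unseparated (V ∪ X) (insert (u, v) D) (insert u (insert v X)) := by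
    refine ⟨?_, ?_, ?_⟩
    · have : ({u, v, x₀} : Finset (Fin n)) ⊆ insert u (insert v X) := by
        intro y hy
        simp only [Finset.mem_insert, Finset.mem_singleton] at hy ⊢
        rcases hy with rfl | rfl | rfl <;> simp [hx₀]
      refine le_trans (le_of_eq ?_) (Finset.card_le_card this)
      rw [Finset.card_eq_three.2 ⟨u, v, x₀, hlt.ne, hx₀'.1.ne, hx₀'.2.ne', rfl⟩]
    · intro y hy
      simp only [Finset.mem_insert, Finset.mem_union] at hy ⊢
      rcases hy with rfl | rfl | hy
      exacts [Or.inl hu, Or.inl hv, Or.inr hy]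
    · have hmem : ∀ y ∈ insert u (insert v X), u ≤ y ∧ y ≤ v := by
        intro y hy
        simp only [Finset.mem_insert] at hy
        rcases hy with rfl | rfl | hy
        exacts [⟨le_rfl, hlt.le⟩, ⟨hlt.le, le_rfl⟩, ⟨(hX y hy).1.le, (hX y hy).2.le⟩]
      intro d hd
      rw [Finset.mem_insert] at hd
      rcases hd with rfl | hd
      · exact Or.inl hmem
      · rcases hcon _ (hD d hd).1 with h1 | h1
        · rcases hcon _ (hD d hd).2 with h2 | h2
          · exact Or.inr fun y hy => Or.inr (h2.trans (hmem y hy).1)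
          · exact Or.inl fun y hy => ⟨h1.trans (hmem y hy).1, (hmem y hy).2.trans h2⟩
        · exact Or.inr fun y hy => Or.inl ((hmem y hy).2.trans h1)
  -- The edge `u v` itself separates the enlarged polygon, so an unseparated set lies in the new
  -- cell or in the old polygon. The two share only `u` and `v`, too few for a subpolygon.
  have hside : ∀ S, Unseparated (V ∪ X) (insert (u, v) D) S →
      S ⊆ insert u (insert v X) ∨ Unseparated V D S := by
    rintro S ⟨h3, hS, hd⟩
    rcases hd (u, v) (Finset.mem_insert_self _ _) with h | h
    · left
      intro y hy
      have := h y hy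
      simp only [Finset.mem_insert]
      rcases Finset.mem_union.1 (hS hy) with hyV | hyX
      · rcases hcon y hyV with h' | h'
        · exact Or.inl (le_antisymm h' this.1)
        · exact Or.inr (Or.inl (le_antisymm this.2 h'))
      · exact Or.inr (Or.inr hyX)
    · right
      refine ⟨h3, fun y hy => ?_, fun d hdD => hd d (Finset.mem_insert_of_mem hdD)⟩
      rcases Finset.mem_union.1 (hS hy) with hyV | hyX
      · exact hyV
      · rcases h y hy with h' | h'
        · exact absurd (hX y hyX).1 (not_lt.2 h')
        · exact absurd (hX y hyX).2 (not_lt.2 h')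
  have hup : ∀ S, Unseparated V D S → Unseparated (V ∪ X) (insert (u, v) D) S := by
    rintro S ⟨h3, hS, hd⟩
    refine ⟨h3, hS.trans Finset.subset_union_left, fun d hdD => ?_⟩
    rcases Finset.mem_insert.1 hdD with rfl | hdD
    · exact Or.inr fun y hy => hcon y (hS hy)
    · exact hd d hdD
  ext S
  rw [Finset.mem_insert, mem_subpolygonsOn, mem_subpolygonsOn]
  constructor
  · intro hS
    rcases hside S hS.prop with h | h
    · exact Or.inl (hS.eq_of_le hE h)
    · exact Or.inr ⟨h, fun S' hS' hle => hS.le_of_ge (hup S' hS') hle⟩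
  · rintro (rfl | hS)
    · refine ⟨hE, fun S' hS' hle => ?_⟩
      rcases hside S' hS' with h | h
      · exact h
      · have hxV := h.2.1 (hle (by simp [hx₀] : x₀ ∈ insert u (insert v X)))
        rcases hcon x₀ hxV with h' | h'
        · exact absurd hx₀'.1 (not_lt.2 h')
        · exact absurd hx₀'.2 (not_lt.2 h')
    · refine ⟨hup S hS.prop, fun S' hS' hle => ?_⟩
      rcases hside S' hS' with h | h
      · exfalso
        have hsub : S ⊆ {u, v} := by
          intro y hy
          have h1 := h (hle hy)
          simp only [Finset.mem_insert, Finset.mem_singleton] at h1 ⊢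
          rcases h1 with h1 | h1 | h1
          · exact Or.inl h1
          · exact Or.inr h1
          · rcases hcon y (hS.prop.2.1 hy) with h' | h'
            · exact absurd (hX y h1).1 (not_lt.2 h')
            · exact absurd (hX y h1).2 (not_lt.2 h')
        have := Finset.card_le_card hsub
        rw [Finset.card_pair hlt.ne] at this
        have := hS.prop.1
        omega
      · exact hS.le_of_ge h hle

lemma notMem_subpolygonsOn_glue {n : ℕ} {V X : Finset (Fin n)} {D : Finset (Fin n × Fin n)}
    {u v : Fin n} (huv : Consec V u v) (hX : ∀ x ∈ X, u < x ∧ x < v) (hne : X.Nonempty) :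
    insert u (insert v X) ∉ subpolygonsOn V D := by
  obtain ⟨x, hx⟩ := hne
  intro h
  have hxV := (mem_subpolygonsOn.1 h).prop.2.1 (by simp [hx] : x ∈ insert u (insert v X))
  have := hX x hx
  rcases huv.2.2.2 x hxV with h' | h'
  · exact absurd this.1 (not_lt.2 h')
  · exact absurd this.2 (not_lt.2 h')

lemma incidence_glue {n : ℕ} {V X : Finset (Fin n)} {D : Finset (Fin n × Fin n)}
    {u v : Fin n} (hD : ∀ d ∈ D, d.1 ∈ V ∧ d.2 ∈ V) (huv : Consec V u v)
    (hX : ∀ x ∈ X, u < x ∧ x < v) (hne : X.Nonempty) (x : Fin n) :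
    incidence (V ∪ X) (insert (u, v) D) x =
      incidence V D x + if x = u ∨ x = v ∨ x ∈ X then 1 else 0 := by
  have hnot := notMem_subpolygonsOn_glue (D := D) huv hX hne
  unfold incidence
  rw [subpolygonsOn_glue hD huv hX hne, Finset.filter_insert]
  have hiff : x ∈ insert u (insert v X) ↔ x = u ∨ x = v ∨ x ∈ X := by simp
  by_cases h : x = u ∨ x = v ∨ x ∈ X
  · rw [if_pos (hiff.2 h), if_pos h, Finset.card_insert_of_notMem]
    intro h'
    exact hnot (Finset.mem_filter.1 h').1
  · rw [if_neg (fun h' => h (hiff.1 h')), if_neg h, add_zero]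

lemma subpolygonsOn_eq_empty {n : ℕ} {V : Finset (Fin n)} (D : Finset (Fin n × Fin n))
    (hV : V.card ≤ 2) : subpolygonsOn V D = ∅ := by
  refine Finset.eq_empty_of_forall_notMem fun S hS => ?_
  have h := (mem_subpolygonsOn.1 hS).prop
  have := Finset.card_le_card h.2.1
  have := h.1
  omega

/-- `Glued p a b V D q`: the polygon with vertex set `V`, first vertex `a` and last vertex `b`, is
obtained from the edge `a b` by repeatedly gluing a `p`-gon along an outer edge (other than the
edge from the last to the first vertex). `D` is the set of the edges used for gluing, and `q` counts
the `p`-gons at the vertices. -/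
inductive Glued (p : ℕ) {n : ℕ} (a b : Fin n) :
    Finset (Fin n) → Finset (Fin n × Fin n) → (Fin n → ℕ) → Prop
  | edge (h : a < b) : Glued p a b {a, b} ∅ (fun _ => 0)
  | glue {V X : Finset (Fin n)} {D : Finset (Fin n × Fin n)} {q q' : Fin n → ℕ} {u v : Fin n}
      (hG : Glued p a b V D q) (huv : Consec V u v) (hX : ∀ x ∈ X, u < x ∧ x < v)
      (hcard : X.card + 2 = p)
      (hq : ∀ x, q' x = q x + if x = u ∨ x = v ∨ x ∈ X then 1 else 0) :
      Glued p a b (V ∪ X) (insert (u, v) D) q'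

/-- Every dissection into `p`-gons arises by gluing. -/
theorem glued_of_dissection {n : ℕ} (p : ℕ) (a b : Fin n) (hab : a < b) :
    ∀ (N : ℕ) (V : Finset (Fin n)) (D : Finset (Fin n × Fin n)), V.card ≤ N → a ∈ V → b ∈ V →
      (∀ x ∈ V, a ≤ x ∧ x ≤ b) → (∀ d ∈ D, d.1 ∈ V ∧ d.2 ∈ V) →
      (∀ d ∈ D, ∃ x ∈ V, d.1 < x ∧ x < d.2) → (∀ d ∈ D, ∀ e ∈ D, ¬ Crosses d e) →
      (3 ≤ V.card → (a, b) ∈ D) → (∀ S ∈ subpolygonsOn V D, S.card = p) →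
      Glued p a b V D (incidence V D) := by
  intro N
  induction N with
  | zero =>
    intro V D hV ha
    exact absurd ha (by rw [Finset.card_eq_zero.1 (by omega : V.card = 0)]; simp)
  | succ N ih =>
    intro V D hVN ha hb hbd hDV hbet hcr hout hsub
    have hpair : ({a, b} : Finset (Fin n)) ⊆ V := by
      intro x hx
      simp only [Finset.mem_insert, Finset.mem_singleton] at hx
      rcases hx with rfl | rfl <;> assumption
    by_cases h3 : 3 ≤ V.card
    -- An element of `D` with the fewest vertices strictly below it bounds an innermost cell: no
    -- other element of `D` has an endpoint below it, so this cell can be cut off.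
    · obtain ⟨d, hd, hmin⟩ := D.exists_min_image
        (fun d => (V.filter (fun x => d.1 < x ∧ x < d.2)).card) ⟨_, hout h3⟩
      obtain ⟨u, v⟩ := d
      set X := V.filter (fun x => u < x ∧ x < v) with hXdef
      have hXmem : ∀ x ∈ X, u < x ∧ x < v := fun x hx => (Finset.mem_filter.1 hx).2
      have hne : X.Nonempty := by
        obtain ⟨x, hx, h⟩ := hbet _ hd
        exact ⟨x, Finset.mem_filter.2 ⟨hx, h⟩⟩
      have huvlt : u < v := by
        obtain ⟨x, hx⟩ := hne
        exact (hXmem x hx).1.trans (hXmem x hx).2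
      have huV := (hDV _ hd).1
      have hvV := (hDV _ hd).2
      dsimp only at huV hvV
      have hV'mem : ∀ x, x ∈ V \ X ↔ x ∈ V ∧ ¬ (u < x ∧ x < v) := by
        intro x
        rw [Finset.mem_sdiff, hXdef, Finset.mem_filter]
        tauto
      have hend : ∀ e ∈ D.erase (u, v), e.1 ∈ V \ X ∧ e.2 ∈ V \ X := by
        intro e he
        have heD := Finset.mem_of_mem_erase he
        have hc1 := hcr _ hd _ heD
        have hc2 := hcr _ heD _ hd
        unfold Crosses at hc1 hc2
        dsimp only at hc1 hc2
        obtain ⟨z, hzV, hz1, hz2⟩ := hbet e heD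
        have key : ∀ y ∈ X, u ≤ e.1 → e.2 ≤ v → (y = e.1 ∨ y = e.2) → False := by
          intro y hy h1 h2 hye
          refine absurd (hmin e heD) (not_le.2 (Finset.card_lt_card ?_))
          rw [Finset.ssubset_iff_of_subset]
          · refine ⟨y, hy, fun hy' => ?_⟩
            have := (Finset.mem_filter.1 hy').2
            rcases hye with rfl | rfl
            · exact lt_irrefl _ this.1
            · exact lt_irrefl _ this.2
          · intro t ht
            have := Finset.mem_filter.1 ht
            exact Finset.mem_filter.2
              ⟨this.1, h1.trans_lt this.2.1, this.2.2.trans_le h2⟩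
        refine ⟨(hV'mem _).2 ⟨(hDV e heD).1, fun h => ?_⟩,
          (hV'mem _).2 ⟨(hDV e heD).2, fun h => ?_⟩⟩
        · refine key e.1 (Finset.mem_filter.2 ⟨(hDV e heD).1, h⟩) h.1.le ?_ (Or.inl rfl)
          by_contra hlt
          exact hc1 ⟨h.1, h.2, not_le.1 hlt⟩
        · refine key e.2 (Finset.mem_filter.2 ⟨(hDV e heD).2, h⟩) ?_ h.2.le (Or.inr rfl)
          by_contra hlt
          exact hc2 ⟨not_le.1 hlt, h.1, h.2⟩
      have hcon : Consec (V \ X) u v := by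
        refine ⟨(hV'mem u).2 ⟨huV, fun h => lt_irrefl _ h.1⟩,
          (hV'mem v).2 ⟨hvV, fun h => lt_irrefl _ h.2⟩, huvlt, fun x hx => ?_⟩
        have := ((hV'mem x).1 hx).2
        by_contra h
        push Not at h
        exact this h
      have hVeq : V \ X ∪ X = V :=
        Finset.sdiff_union_of_subset (Finset.filter_subset _ _)
      have hDeq : insert (u, v) (D.erase (u, v)) = D := Finset.insert_erase hd
      have hglue := subpolygonsOn_glue hend hcon hXmem hne
      have hinc := incidence_glue hend hcon hXmem hne
      rw [hVeq, hDeq] at hglue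
      rw [hVeq, hDeq] at hinc
      have hcard : X.card + 2 = p := by
        have h := hsub (insert u (insert v X)) (by rw [hglue]; exact Finset.mem_insert_self _ _)
        rw [Finset.card_insert_of_notMem, Finset.card_insert_of_notMem] at h
        · exact h
        · exact fun h => lt_irrefl _ (hXmem v h).2
        · rw [Finset.mem_insert]
          rintro (h | h)
          · exact huvlt.ne h
          · exact lt_irrefl _ (hXmem u h).1
      have hIH : Glued p a b (V \ X) (D.erase (u, v)) (incidence (V \ X) (D.erase (u, v))) := by
        apply ih
        · have : (V \ X).card < V.card := Finset.card_lt_card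
            (Finset.sdiff_ssubset (Finset.filter_subset _ _ : X ⊆ V) hne)
          omega
        · exact (hV'mem a).2 ⟨ha, fun h => absurd h.1 (not_lt.2 (hbd u huV).1)⟩
        · exact (hV'mem b).2 ⟨hb, fun h => absurd h.2 (not_lt.2 (hbd v hvV).2)⟩
        · exact fun x hx => hbd x ((hV'mem x).1 hx).1
        · exact hend
        · intro e he
          obtain ⟨hne', heD⟩ := Finset.mem_erase.1 he
          obtain ⟨x, hxV, hx1, hx2⟩ := hbet e heD
          -- If the vertex below `e` is cut off with `X`, then `e` spans `u v`; as `e ≠ (u, v)`, one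
          -- of `u`, `v` lies strictly below `e` and replaces it.
          by_cases hx : u < x ∧ x < v
          · obtain ⟨h1, h2⟩ := hend e he
            rcases hcon.2.2.2 _ h1 with h1 | h1
            · rcases hcon.2.2.2 _ h2 with h2 | h2
              · exact absurd (hx2.trans_le h2) (not_lt.2 hx.1.le)
              · rcases h1.lt_or_eq with h1 | h1
                · exact ⟨u, hcon.1, h1, huvlt.trans_le h2⟩
                · rcases h2.lt_or_eq with h2 | h2
                  · exact ⟨v, hcon.2.1, h1 ▸ huvlt, h2⟩
                  · exact absurd (Prod.ext h1 h2.symm) hne'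
            · exact absurd (hx.2.trans_le h1) (not_lt.2 hx1.le)
          · exact ⟨x, (hV'mem x).2 ⟨hxV, hx⟩, hx1, hx2⟩
        · exact fun d hd e he =>
            hcr d (Finset.mem_of_mem_erase hd) e (Finset.mem_of_mem_erase he)
        · intro h3'
          -- Were `(a, b)` the edge cut along, only `a` and `b` would remain.
          refine Finset.mem_erase.2 ⟨fun h => ?_, hout h3⟩
          have hsubs : V \ X ⊆ {a, b} := by
            intro x hx
            have h1 := hcon.2.2.2 x hx
            have h2 := hbd x ((hV'mem x).1 hx).1
            obtain ⟨rfl, rfl⟩ := Prod.ext_iff.1 h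
            simp only [Finset.mem_insert, Finset.mem_singleton]
            rcases h1 with h1 | h1
            · exact Or.inl (le_antisymm h1 h2.1)
            · exact Or.inr (le_antisymm h2.2 h1)
          have := Finset.card_le_card hsubs
          rw [Finset.card_pair hab.ne] at this
          omega
        · exact fun S hS => hsub S (by rw [hglue]; exact Finset.mem_insert_of_mem hS)
      have := Glued.glue hIH hcon hXmem hcard hinc
      rwa [hVeq, hDeq] at this
    · have hVeq : V = {a, b} := by
        refine (Finset.eq_of_subset_of_card_le hpair ?_).symm
        rw [Finset.card_pair hab.ne]
        omega
      have hD : D = ∅ := by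
        refine Finset.eq_empty_of_forall_notMem fun d hd => ?_
        obtain ⟨x, hx, hx1, hx2⟩ := hbet d hd
        have h1 := (hbd _ (hDV d hd).1).1
        have h2 := (hbd _ (hDV d hd).2).2
        rw [hVeq] at hx
        simp only [Finset.mem_insert, Finset.mem_singleton] at hx
        rcases hx with rfl | rfl
        · exact absurd hx1 (not_lt.2 h1)
        · exact absurd hx2 (not_lt.2 h2)
      have hinc : incidence V D = fun _ => 0 := by
        funext x
        simp [incidence, subpolygonsOn_eq_empty D (by omega : V.card ≤ 2)]
      rw [hinc, hD, hVeq]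
      exact Glued.edge hab

namespace Glued

variable {p n : ℕ} {a b : Fin n} {V : Finset (Fin n)} {D : Finset (Fin n × Fin n)} {q : Fin n → ℕ}

lemma endpoints_mem (h : Glued p a b V D q) : ∀ d ∈ D, d.1 ∈ V ∧ d.2 ∈ V := by
  induction h with
  | edge h => simp
  | glue hG huv hX hcard hq ih =>
    intro d hd
    rcases Finset.mem_insert.1 hd with rfl | hd
    · exact ⟨Finset.mem_union_left _ huv.1, Finset.mem_union_left _ huv.2.1⟩
    · exact ⟨Finset.mem_union_left _ (ih d hd).1, Finset.mem_union_left _ (ih d hd).2⟩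

lemma bounds (h : Glued p a b V D q) : a ∈ V ∧ b ∈ V ∧ ∀ x ∈ V, a ≤ x ∧ x ≤ b := by
  induction h with
  | edge h =>
    refine ⟨by simp, by simp, fun x hx => ?_⟩
    simp only [Finset.mem_insert, Finset.mem_singleton] at hx
    rcases hx with rfl | rfl
    exacts [⟨le_rfl, h.le⟩, ⟨h.le, le_rfl⟩]
  | glue hG huv hX hcard hq ih =>
    obtain ⟨ha, hb, hbd⟩ := ih
    refine ⟨Finset.mem_union_left _ ha, Finset.mem_union_left _ hb, fun x hx => ?_⟩
    rcases Finset.mem_union.1 hx with hx | hx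
    · exact hbd x hx
    · exact ⟨(hbd _ huv.1).1.trans (hX x hx).1.le, (hX x hx).2.le.trans (hbd _ huv.2.1).2⟩

lemma eq_zero (h : Glued p a b V D q) : ∀ x, x ∉ V → q x = 0 := by
  induction h with
  | edge h => simp
  | glue hG huv hX hcard hq ih =>
    intro x hx
    rw [Finset.mem_union, not_or] at hx
    rw [hq, ih x hx.1, if_neg]
    rintro (rfl | rfl | h)
    exacts [hx.1 huv.1, hx.1 huv.2.1, hx.2 h]

/-- Converse of `glued_of_dissection`. Earlier edges end in the old polygon, where `u` and `v` are
neighbours, so none of them crosses `u v`. -/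
lemma dissection (hp : 3 ≤ p) (h : Glued p a b V D q) :
    (∀ d ∈ D, ∃ x ∈ V, d.1 < x ∧ x < d.2) ∧ (∀ d ∈ D, ∀ e ∈ D, ¬ Crosses d e) ∧
      (∀ S ∈ subpolygonsOn V D, S.card = p) ∧ q = incidence V D := by
  induction h with
  | edge h =>
    refine ⟨by simp, by simp, ?_, ?_⟩
    · rw [subpolygonsOn_eq_empty _ (Finset.card_pair h.ne).le]
      simp
    · funext x
      simp [incidence, subpolygonsOn_eq_empty _ (Finset.card_pair h.ne).le]
  | @glue V X D q q' u v hG huv hX hcard hq ih =>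
    obtain ⟨hbet, hcr, hsub, hinc⟩ := ih
    have hne : X.Nonempty := Finset.card_pos.1 (by omega)
    have hend := hG.endpoints_mem
    refine ⟨?_, ?_, ?_, ?_⟩
    · intro d hd
      rcases Finset.mem_insert.1 hd with rfl | hd
      · obtain ⟨x, hx⟩ := hne
        exact ⟨x, Finset.mem_union_right _ hx, hX x hx⟩
      · obtain ⟨x, hx, h⟩ := hbet d hd
        exact ⟨x, Finset.mem_union_left _ hx, h⟩
    · intro d hd e he hc
      unfold Crosses at hc
      rcases Finset.mem_insert.1 hd with rfl | hd
      · rcases Finset.mem_insert.1 he with rfl | he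
        · exact lt_irrefl _ hc.1
        · rcases huv.2.2.2 _ (hend e he).1 with h | h
          · exact absurd hc.1 (not_lt.2 h)
          · exact absurd hc.2.1 (not_lt.2 h)
      · rcases Finset.mem_insert.1 he with rfl | he
        · rcases huv.2.2.2 _ (hend d hd).2 with h | h
          · exact absurd hc.2.1 (not_lt.2 h)
          · exact absurd hc.2.2 (not_lt.2 h)
        · exact hcr d hd e he hc
    · intro S hS
      rw [subpolygonsOn_glue hend huv hX hne] at hS
      rcases Finset.mem_insert.1 hS with rfl | hS
      · rw [Finset.card_insert_of_notMem, Finset.card_insert_of_notMem]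
        · exact hcard
        · exact fun h => lt_irrefl _ (hX v h).2
        · rw [Finset.mem_insert]
          rintro (h | h)
          · exact huv.2.2.1.ne h
          · exact lt_irrefl _ (hX u h).1
      · exact hsub S hS
    · funext x
      rw [hq, incidence_glue hend huv hX hne, hinc]

end Glued

/-! ### Gluings and angulations of the whole polygon. -/

/-- The outer edge from the first to the last vertex separates nothing. -/
lemma onOneSide_outer {w : ℕ} (S : Finset (Fin (w + 3))) : OnOneSide (0, Fin.last (w + 2)) S :=
  Or.inl fun x _ => ⟨Fin.zero_le x, Fin.le_last x⟩

/-- Gluing records the outer edge `(0, Fin.last (w + 2))`, which is not a diagonal. It separates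
nothing, so it may be added or erased freely. -/
lemma subpolygonsOn_univ {w : ℕ} {D D' : Finset (Fin (w + 3) × Fin (w + 3))}
    (h : ∀ d, d ≠ (0, Fin.last (w + 2)) → (d ∈ D ↔ d ∈ D')) :
    subpolygonsOn Finset.univ D' = subpolygons D := by
  have : Unseparated Finset.univ D' =
      fun S : Finset (Fin (w + 3)) => 3 ≤ S.card ∧ ∀ d ∈ D, OnOneSide d S := by
    funext S
    simp only [Unseparated, Finset.subset_univ, true_and, eq_iff_iff, and_congr_right_iff]
    intro _
    refine forall_congr' fun d => ?_
    by_cases hd : d = (0, Fin.last (w + 2))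
    · simp [hd, onOneSide_outer]
    · rw [h d hd]
  unfold subpolygonsOn subpolygons IsSubpolygon
  rw [this]

lemma quiddity_eq {w p : ℕ} {D D' : Finset (Fin (w + 3) × Fin (w + 3))}
    (hp : ∀ S ∈ subpolygons D, S.card = p)
    (h : ∀ d, d ≠ (0, Fin.last (w + 2)) → (d ∈ D ↔ d ∈ D')) (x : Fin (w + 3)) :
    quiddity D x = lam p * incidence Finset.univ D' x := by
  unfold quiddity incidence
  rw [subpolygonsOn_univ h, Finset.sum_congr rfl
    (fun S hS => by rw [hp S (Finset.mem_filter.1 hS).1] : ∀ S ∈ (subpolygons D).filter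
      (fun S => x ∈ S), lam S.card = lam p), Finset.sum_const, nsmul_eq_mul, mul_comm]

theorem IsAngulation.glued {w p : ℕ} {D : Finset (Fin (w + 3) × Fin (w + 3))}
    (hD : IsAngulation p D) :
    ∃ q, Glued p 0 (Fin.last (w + 2)) Finset.univ (insert (0, Fin.last (w + 2)) D) q ∧
      ∀ x, quiddity D x = lam p * q x := by
  obtain ⟨⟨hdiag, hcr⟩, hcard⟩ := hD
  have hiff : ∀ d, d ≠ (0, Fin.last (w + 2)) →
      (d ∈ D ↔ d ∈ insert (0, Fin.last (w + 2)) D) := by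
    intro d hd
    simp [hd]
  refine ⟨_, glued_of_dissection p 0 (Fin.last (w + 2)) (Fin.last_pos) _ Finset.univ
    (insert (0, Fin.last (w + 2)) D) le_rfl (Finset.mem_univ _) (Finset.mem_univ _)
    (fun x _ => ⟨Fin.zero_le x, Fin.le_last x⟩)
    (fun d _ => ⟨Finset.mem_univ _, Finset.mem_univ _⟩) ?_ ?_
    (fun _ => Finset.mem_insert_self _ _) ?_, quiddity_eq hcard hiff⟩
  · intro d hd
    rcases Finset.mem_insert.1 hd with rfl | hd
    · refine ⟨⟨1, by omega⟩, Finset.mem_univ _, ?_, ?_⟩ <;> rw [Fin.lt_def] <;> simp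
    · have h := (hdiag d hd).1
      have h2 := d.2.isLt
      refine ⟨⟨d.1.val + 1, by omega⟩, Finset.mem_univ _, ?_, ?_⟩ <;> rw [Fin.lt_def]
      · exact Nat.lt_succ_self _
      · exact h
  · intro d hd e he hc
    unfold Crosses at hc
    rcases Finset.mem_insert.1 hd with rfl | hd
    · exact absurd hc.2.2 (not_lt.2 (Fin.le_last _))
    · rcases Finset.mem_insert.1 he with rfl | he
      · exact absurd hc.1 (not_lt.2 (Fin.zero_le _))
      · exact hcr d hd e he hc
  · rw [subpolygonsOn_univ hiff]
    exact hcard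

theorem Glued.isAngulation {w p : ℕ} (hp : 3 ≤ p) {D : Finset (Fin (w + 3) × Fin (w + 3))}
    {q : Fin (w + 3) → ℕ} (h : Glued p 0 (Fin.last (w + 2)) Finset.univ D q) :
    IsAngulation p (D.erase (0, Fin.last (w + 2))) ∧
      ∀ x, quiddity (D.erase (0, Fin.last (w + 2))) x = lam p * q x := by
  obtain ⟨hbet, hcr, hsub, hinc⟩ := h.dissection hp
  have hiff : ∀ d, d ≠ (0, Fin.last (w + 2)) →
      (d ∈ D.erase (0, Fin.last (w + 2)) ↔ d ∈ D) := by
    intro d hd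
    simp [hd]
  have hsub' : ∀ S ∈ subpolygons (D.erase (0, Fin.last (w + 2))), S.card = p := by
    rw [← subpolygonsOn_univ hiff]
    exact hsub
  refine ⟨⟨⟨?_, ?_⟩, hsub'⟩, fun x => by rw [quiddity_eq hsub' hiff, ← hinc]⟩
  · intro d hd
    obtain ⟨hne, hd⟩ := Finset.mem_erase.1 hd
    obtain ⟨x, _, hx1, hx2⟩ := hbet d hd
    rw [Fin.lt_def] at hx1 hx2
    refine ⟨by omega, fun ⟨h1, h2⟩ => hne (Prod.ext (Fin.ext ?_) (Fin.ext ?_))⟩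
    · simpa using h1
    · simp only [Fin.val_last]
      omega
  · exact fun d hd e he => hcr d (Finset.mem_of_mem_erase hd) e (Finset.mem_of_mem_erase he)

/-! ### Integral plane vectors on a triangulated polygon. -/

/-- The determinant of two plane vectors. -/
def pdet (x y : ℤ × ℤ) : ℤ := x.1 * y.2 - x.2 * y.1

lemma pdet_add_left (x y z : ℤ × ℤ) : pdet (x + y) z = pdet x z + pdet y z := by
  simp only [pdet, Prod.fst_add, Prod.snd_add]; ring

lemma pdet_add_right (x y z : ℤ × ℤ) : pdet x (y + z) = pdet x y + pdet x z := by
  simp only [pdet, Prod.fst_add, Prod.snd_add]; ring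

lemma pdet_self (x : ℤ × ℤ) : pdet x x = 0 := by
  simp only [pdet]; ring

/-- Neighbours after inserting a vertex. -/
lemma consec_union_singleton {n : ℕ} {V : Finset (Fin n)} {u v x : Fin n} (huv : Consec V u v)
    (hx : u < x ∧ x < v) (y z : Fin n) :
    Consec (V ∪ {x}) y z ↔
      (y = u ∧ z = x) ∨ (y = x ∧ z = v) ∨ (Consec V y z ∧ ¬ (y = u ∧ z = v)) := by
  obtain ⟨hu, hv, hlt, hcon⟩ := huv
  have hxV : x ∉ V := fun h => by
    rcases hcon x h with h' | h'
    · exact absurd hx.1 (not_lt.2 h')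
    · exact absurd hx.2 (not_lt.2 h')
  constructor
  · rintro ⟨hy, hz, hyz, hc⟩
    simp only [Finset.mem_union, Finset.mem_singleton] at hy hz hc
    rcases hy with hy | rfl
    · rcases hz with hz | rfl
      · refine Or.inr (Or.inr ⟨⟨hy, hz, hyz, fun t ht => hc t (Or.inl ht)⟩, ?_⟩)
        rintro ⟨rfl, rfl⟩
        rcases hc x (Or.inr rfl) with h | h
        · exact absurd hx.1 (not_lt.2 h)
        · exact absurd hx.2 (not_lt.2 h)
      · refine Or.inl ⟨le_antisymm ?_ ?_, rfl⟩
        · rcases hcon y hy with h | h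
          · exact h
          · exact absurd (hyz.trans hx.2) (not_lt.2 h)
        · rcases hc u (Or.inl hu) with h | h
          · exact h
          · exact absurd hx.1 (not_lt.2 h)
    · rcases hz with hz | rfl
      · refine Or.inr (Or.inl ⟨rfl, le_antisymm ?_ ?_⟩)
        · rcases hc v (Or.inl hv) with h | h
          · exact absurd hx.2 (not_lt.2 h)
          · exact h
        · rcases hcon z hz with h | h
          · exact absurd (hx.1.trans hyz) (not_lt.2 h)
          · exact h
      · exact absurd hyz (lt_irrefl _)
  · rintro (⟨rfl, rfl⟩ | ⟨rfl, rfl⟩ | ⟨⟨hy, hz, hyz, hc⟩, hne⟩)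
    · refine ⟨by simp [hu], by simp, hx.1, fun t ht => ?_⟩
      simp only [Finset.mem_union, Finset.mem_singleton] at ht
      rcases ht with ht | rfl
      · exact (hcon t ht).imp_right hx.2.le.trans
      · exact Or.inr le_rfl
    · refine ⟨by simp, by simp [hv], hx.2, fun t ht => ?_⟩
      simp only [Finset.mem_union, Finset.mem_singleton] at ht
      rcases ht with ht | rfl
      · exact (hcon t ht).imp_left (fun h => h.trans hx.1.le)
      · exact Or.inl le_rfl
    · refine ⟨by simp [hy], by simp [hz], hyz, fun t ht => ?_⟩
      simp only [Finset.mem_union, Finset.mem_singleton] at ht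
      rcases ht with ht | rfl
      · exact hc t ht
      · by_contra h
        push Not at h
        apply hne
        constructor
        · refine le_antisymm ?_ ?_
          · rcases hcon y hy with h' | h'
            · exact h'
            · exact absurd (h.1.trans hx.2) (not_lt.2 h')
          · rcases hc u hu with h' | h'
            · exact h'
            · exact absurd (hx.1.trans h.2) (not_lt.2 h')
        · refine le_antisymm ?_ ?_
          · rcases hc v hv with h' | h'
            · exact absurd (h.1.trans hx.2) (not_lt.2 h')
            · exact h'
          · rcases hcon z hz with h' | h'
            · exact absurd (hx.1.trans h.2) (not_lt.2 h')
            · exact h'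

lemma Consec.right_unique {n : ℕ} {V : Finset (Fin n)} {u v v' : Fin n} (h : Consec V u v)
    (h' : Consec V u v') : v = v' := by
  refine le_antisymm ?_ ?_
  · exact (h.2.2.2 v' h'.2.1).resolve_left (not_le.2 h'.2.2.1)
  · exact (h'.2.2.2 v h.2.1).resolve_left (not_le.2 h.2.2.1)

lemma Consec.left_unique {n : ℕ} {V : Finset (Fin n)} {u u' v : Fin n} (h : Consec V u v)
    (h' : Consec V u' v) : u = u' := by
  refine le_antisymm ?_ ?_
  · exact (h'.2.2.2 u h.1).resolve_right (not_le.2 h.2.2.1)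
  · exact (h.2.2.2 u' h'.1).resolve_right (not_le.2 h'.2.2.1)

/-- Integral plane vectors attached to the vertices of a triangulated polygon: neighbours in the
triangulation have determinant `1`, and the sum of the two outer neighbours of a vertex is the
vertex times the number of its triangles. -/
structure IsLabelling {n : ℕ} (a b : Fin n) (V : Finset (Fin n)) (T : Finset (Fin n × Fin n))
    (q : Fin n → ℕ) (v : Fin n → ℤ × ℤ) : Prop where
  pos : ∀ x ∈ V, ∀ y ∈ V, x < y → 0 < pdet (v x) (v y)
  eq_one_iff : ∀ x ∈ V, ∀ y ∈ V, x < y → (pdet (v x) (v y) = 1 ↔ Consec V x y ∨ (x, y) ∈ T)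
  outer : pdet (v a) (v b) = 1
  add : ∀ x y z, Consec V x y → Consec V y z → v x + v z = (q y : ℤ) • v y
  first : ∀ x, Consec V a x → v x - v b = (q a : ℤ) • v a
  last : ∀ x, Consec V x b → v x - v a = (q b : ℤ) • v b

/-- The tip of a triangle glued to `u v` receives `f u + f v`. Its determinant with another vertex
is a sum of two positive integers, hence at least 2, unless that vertex is `u` or `v`, where one
summand vanishes and the other is 1. -/
theorem Glued.exists_isLabelling {n : ℕ} {a b : Fin n} {V : Finset (Fin n)}
    {T : Finset (Fin n × Fin n)} {q : Fin n → ℕ} (h : Glued 3 a b V T q) :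
    ∃ v, IsLabelling a b V T q v := by
  induction h with
  | edge h =>
    refine ⟨fun x => if x = a then (1, 0) else (0, 1), ?_, ?_, ?_, ?_, ?_, ?_⟩
    · intro x hx y hy hxy
      simp only [Finset.mem_insert, Finset.mem_singleton] at hx hy
      rcases hx with rfl | rfl <;> rcases hy with rfl | rfl
      · exact absurd hxy (lt_irrefl _)
      · simp [pdet, hxy.ne']
      · exact absurd hxy (not_lt.2 h.le)
      · exact absurd hxy (lt_irrefl _)
    · intro x hx y hy hxy
      simp only [Finset.mem_insert, Finset.mem_singleton] at hx hy
      rcases hx with rfl | rfl <;> rcases hy with rfl | rfl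
      · exact absurd hxy (lt_irrefl _)
      · simp only [if_true, if_neg hxy.ne', pdet]
        norm_num
        exact ⟨by simp, by simp, hxy, by simp⟩
      · exact absurd hxy (not_lt.2 h.le)
      · exact absurd hxy (lt_irrefl _)
    · simp [pdet, h.ne']
    · rintro x y z ⟨hx, hy, hxy, -⟩ ⟨-, hz, hyz, -⟩
      simp only [Finset.mem_insert, Finset.mem_singleton] at hx hy hz
      exfalso
      rcases hx with rfl | rfl <;> rcases hy with rfl | rfl <;> rcases hz with rfl | rfl <;>
        first
        | exact absurd hxy (lt_irrefl _)
        | exact absurd hyz (lt_irrefl _)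
        | exact absurd hxy (not_lt.2 h.le)
        | exact absurd hyz (not_lt.2 h.le)
    · rintro x ⟨-, hx, hlt, -⟩
      simp only [Finset.mem_insert, Finset.mem_singleton] at hx
      rcases hx with rfl | rfl
      · exact absurd hlt (lt_irrefl _)
      · simp
    · rintro x ⟨hx, -, hlt, -⟩
      simp only [Finset.mem_insert, Finset.mem_singleton] at hx
      rcases hx with rfl | rfl
      · simp
      · exact absurd hlt (lt_irrefl _)
  | @glue V X T q q' u v hG huv hX hcard hq ih =>
    obtain ⟨f, hf⟩ := ih
    obtain ⟨x, rfl⟩ := Finset.card_eq_one.1 (by omega : X.card = 1)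
    have hx : u < x ∧ x < v := hX x (by simp)
    have hend := hG.endpoints_mem
    obtain ⟨ha, hb, -⟩ := hG.bounds
    have hxV : x ∉ V := fun h => by
      rcases huv.2.2.2 x h with h' | h'
      · exact absurd hx.1 (not_lt.2 h')
      · exact absurd hx.2 (not_lt.2 h')
    have hneV : ∀ y ∈ V, y ≠ x := fun y hy h => hxV (h ▸ hy)
    obtain ⟨g, hgx, hgV⟩ : ∃ g : Fin n → ℤ × ℤ, g x = f u + f v ∧ ∀ y ∈ V, g y = f y :=
      ⟨Function.update f x (f u + f v), by simp,
        fun y hy => Function.update_of_ne (hneV y hy) _ _⟩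
    have huv1 : pdet (f u) (f v) = 1 :=
      (hf.eq_one_iff u huv.1 v huv.2.1 huv.2.2.1).2 (Or.inl huv)
    have hqx : q' x = 1 := by simp [hq, hG.eq_zero x hxV]
    have hqu : q' u = q u + 1 := by simp [hq]
    have hqv : q' v = q v + 1 := by simp [hq]
    have hqo : ∀ y ∈ V, y ≠ u → y ≠ v → q' y = q y := by
      intro y hy h1 h2
      simp [hq, h1, h2, hneV y hy]
    have hcons := consec_union_singleton huv hx
    have hright : ∀ y ∈ V, x < y →
        0 < pdet (g x) (g y) ∧ (pdet (g x) (g y) = 1 ↔ y = v) := by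
      intro y hy hxy
      have hvy : v ≤ y := (huv.2.2.2 y hy).resolve_left (not_le.2 (hx.1.trans hxy))
      rw [hgx, hgV y hy, pdet_add_left]
      have h1 := hf.pos u huv.1 y hy (hx.1.trans hxy)
      rcases hvy.eq_or_lt with rfl | hlt
      · rw [pdet_self, huv1]
        simp
      · have h2 := hf.pos v huv.2.1 y hy hlt
        refine ⟨by omega, ⟨fun h => by omega, fun h => absurd h hlt.ne'⟩⟩
    have hleft : ∀ y ∈ V, y < x →
        0 < pdet (g y) (g x) ∧ (pdet (g y) (g x) = 1 ↔ y = u) := by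
      intro y hy hxy
      have hvy : y ≤ u := (huv.2.2.2 y hy).resolve_right (not_le.2 (hxy.trans hx.2))
      rw [hgx, hgV y hy, pdet_add_right]
      have h1 := hf.pos y hy v huv.2.1 (hxy.trans hx.2)
      rcases hvy.eq_or_lt with rfl | hlt
      · rw [pdet_self, huv1]
        simp
      · have h2 := hf.pos y hy u huv.1 hlt
        refine ⟨by omega, ⟨fun h => by omega, fun h => absurd h hlt.ne⟩⟩
    refine ⟨g, ?_, ?_, ?_, ?_, ?_, ?_⟩
    · intro y hy z hz hyz
      simp only [Finset.mem_union, Finset.mem_singleton] at hy hz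
      rcases hy with hy | rfl <;> rcases hz with hz | rfl
      · rw [hgV y hy, hgV z hz]
        exact hf.pos y hy z hz hyz
      · exact (hleft y hy hyz).1
      · exact (hright z hz hyz).1
      · exact absurd hyz (lt_irrefl _)
    · intro y hy z hz hyz
      simp only [Finset.mem_union, Finset.mem_singleton] at hy hz
      rw [hcons, Finset.mem_insert, Prod.mk.injEq]
      rcases hy with hy | rfl <;> rcases hz with hz | rfl
      · rw [hgV y hy, hgV z hz, hf.eq_one_iff y hy z hz hyz]
        have h1 := hneV y hy
        have h2 := hneV z hz
        by_cases h : y = u ∧ z = v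
        · obtain ⟨rfl, rfl⟩ := h
          simp [huv]
        · simp [h1, h2, h]
      · rw [(hleft y hy hyz).2]
        constructor
        · exact fun h => Or.inl (Or.inl ⟨h, rfl⟩)
        · rintro ((h | h | h) | h | h)
          · exact h.1
          · exact absurd h.1 (hneV y hy)
          · exact absurd h.1.2.1 hxV
          · exact h.1
          · exact absurd (hend _ h).2 hxV
      · rw [(hright z hz hyz).2]
        constructor
        · exact fun h => Or.inl (Or.inr (Or.inl ⟨rfl, h⟩))
        · rintro ((h | h | h) | h | h)
          · exact absurd h.2 (hneV z hz)
          · exact h.2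
          · exact absurd h.1.1 hxV
          · exact h.2
          · exact absurd (hend _ h).1 hxV
      · exact absurd hyz (lt_irrefl _)
    · rw [hgV a ha, hgV b hb]
      exact hf.outer
    · intro r s t hrs hst
      rw [hcons] at hrs hst
      rcases hrs with ⟨rfl, rfl⟩ | ⟨rfl, rfl⟩ | ⟨hrs, hrs'⟩
      · rcases hst with ⟨h, -⟩ | ⟨-, rfl⟩ | ⟨h, -⟩
        · exact absurd h.symm (hneV _ huv.1)
        · rw [hqx, hgx, hgV _ huv.1, hgV _ huv.2.1]
          simp
        · exact absurd h.1 hxV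
      · rcases hst with ⟨h, -⟩ | ⟨h, -⟩ | ⟨h, -⟩
        · exact absurd huv.2.2.1 (by simp [h])
        · exact absurd h (hneV _ huv.2.1)
        · have := hf.add _ _ _ huv h
          rw [hqv, hgx, hgV _ huv.2.1, hgV _ h.2.1]
          push_cast
          rw [add_smul, one_smul, ← this]
          abel
      · rcases hst with ⟨rfl, rfl⟩ | ⟨rfl, -⟩ | ⟨hst, hst'⟩
        · have := hf.add _ _ _ hrs huv
          rw [hqu, hgx, hgV _ huv.1, hgV _ hrs.1]
          push_cast
          rw [add_smul, one_smul, ← this]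
          abel
        · exact absurd hrs.2.1 hxV
        · rw [hqo s hst.1, hgV _ hrs.1, hgV _ hst.1, hgV _ hst.2.1]
          · exact hf.add _ _ _ hrs hst
          · rintro rfl
            exact hst' ⟨rfl, hst.right_unique huv⟩
          · rintro rfl
            exact hrs' ⟨hrs.left_unique huv, rfl⟩
    · intro y hy
      rw [hcons] at hy
      rcases hy with ⟨rfl, rfl⟩ | ⟨rfl, -⟩ | ⟨hy, hy'⟩
      · have := hf.first _ huv
        rw [hqu, hgx, hgV _ hb, hgV _ ha]
        push_cast
        rw [add_smul, one_smul, ← this]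
        abel
      · exact absurd ha hxV
      · rw [hqo a ha, hgV _ hb, hgV _ ha, hgV _ hy.2.1]
        · exact hf.first _ hy
        · rintro rfl
          exact hy' ⟨rfl, hy.right_unique huv⟩
        · rintro rfl
          exact absurd (hG.bounds.2.2 _ huv.1).1 (not_le.2 huv.2.2.1)
    · intro y hy
      rw [hcons] at hy
      rcases hy with ⟨-, rfl⟩ | ⟨rfl, rfl⟩ | ⟨hy, hy'⟩
      · exact absurd hb hxV
      · have := hf.last _ huv
        rw [hqv, hgx, hgV _ hb, hgV _ ha]
        push_cast
        rw [add_smul, one_smul, ← this]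
        abel
      · rw [hqo b hb, hgV _ hb, hgV _ ha, hgV _ hy.1]
        · exact hf.last _ hy
        · rintro rfl
          exact absurd (hG.bounds.2.2 _ huv.2.1).2 (not_le.2 huv.2.2.1)
        · rintro rfl
          exact hy' ⟨hy.left_unique huv, rfl⟩

/-- The triangle glued last is an ear: its tip lies in no other triangle. -/
lemma Glued.exists_eq_one {n : ℕ} {a b : Fin n} {V : Finset (Fin n)}
    {T : Finset (Fin n × Fin n)} {q : Fin n → ℕ} (h : Glued 3 a b V T q) (hV : 3 ≤ V.card) :
    ∃ x, q x = 1 := by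
  cases h with
  | edge h =>
    rw [Finset.card_pair h.ne] at hV
    omega
  | @glue V X T q _ u v hG huv hX hcard hq =>
    obtain ⟨x, hx⟩ := Finset.card_pos.1 (by omega : 0 < X.card)
    refine ⟨x, ?_⟩
    rw [hq, hG.eq_zero, if_pos (Or.inr (Or.inr hx))]
    intro hxV
    rcases huv.2.2.2 x hxV with h' | h'
    · exact absurd (hX x hx).1 (not_lt.2 h')
    · exact absurd (hX x hx).2 (not_lt.2 h')

lemma consec_univ {n : ℕ} {x y : Fin n} : Consec Finset.univ x y ↔ x.val + 1 = y.val := by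
  simp only [Consec, Finset.mem_univ, true_and, forall_true_left, Fin.lt_def, Fin.le_def]
  constructor
  · rintro ⟨h1, h2⟩
    have := h2 ⟨x.val + 1, by omega⟩
    simp only at this
    omega
  · intro h
    exact ⟨by omega, fun z => by omega⟩

/-! ### Cutting squares and hexagons into triangles. -/

/-- `V` carries a triangulation with `q x` triangles at the vertex `x`. -/
def Triangulates {n : ℕ} (a b : Fin n) (V : Finset (Fin n)) (q : Fin n → ℕ) : Prop :=
  ∃ T, Glued 3 a b V T q

lemma Triangulates.insert {n : ℕ} {a b u v : Fin n} {V : Finset (Fin n)} {q : Fin n → ℕ}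
    (h : Triangulates a b V q) (huv : Consec V u v) {x : Fin n} (hx : u < x ∧ x < v) :
    Triangulates a b (V ∪ {x}) (fun z => q z + if z = u ∨ z = v ∨ z = x then 1 else 0) ∧
      Consec (V ∪ {x}) u x ∧ Consec (V ∪ {x}) x v := by
  obtain ⟨T, hT⟩ := h
  refine ⟨⟨_, Glued.glue (X := {x}) hT huv ?_ rfl ?_⟩, ?_, ?_⟩
  · simpa using hx
  · simp
  · exact (consec_union_singleton huv hx _ _).2 (Or.inl ⟨rfl, rfl⟩)
  · exact (consec_union_singleton huv hx _ _).2 (Or.inr (Or.inl ⟨rfl, rfl⟩))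

lemma Consec.union_of_ne {n : ℕ} {u v y z : Fin n} {V X : Finset (Fin n)} (huv : Consec V u v)
    (hX : ∀ x ∈ X, u < x ∧ x < v) (hyz : Consec V y z) (hne : ¬ (y = u ∧ z = v)) :
    Consec (V ∪ X) y z := by
  refine ⟨Finset.mem_union_left _ hyz.1, Finset.mem_union_left _ hyz.2.1, hyz.2.2.1, ?_⟩
  intro t ht
  rcases Finset.mem_union.1 ht with ht | ht
  · exact hyz.2.2.2 t ht
  · by_contra h
    push Not at h
    have h1 := hX t ht
    have hyu : y ≤ u := (huv.2.2.2 y hyz.1).resolve_right (not_le.2 (h.1.trans h1.2))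
    have hvz : v ≤ z := (huv.2.2.2 z hyz.2.1).resolve_left (not_le.2 (h1.1.trans h.2))
    have huy : u ≤ y := (hyz.2.2.2 u huv.1).resolve_right (not_le.2 (h1.1.trans h.2))
    have hzv : z ≤ v := (hyz.2.2.2 v huv.2.1).resolve_left (not_le.2 (h.1.trans h1.2))
    exact hne ⟨le_antisymm hyu huy, le_antisymm hzv hvz⟩

lemma exists_sorted_pair {n : ℕ} {X : Finset (Fin n)} (h : X.card = 2) :
    ∃ x y, x < y ∧ X = {x, y} := by
  refine ⟨X.orderEmbOfFin h 0, X.orderEmbOfFin h 1, by simp, ?_⟩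
  ext z
  have hz := Set.ext_iff.1 (X.range_orderEmbOfFin h) z
  rw [Set.mem_range, Finset.mem_coe] at hz
  rw [← hz]
  simp only [Fin.exists_fin_succ, Finset.mem_insert, Finset.mem_singleton, eq_comm (a := z)]
  simp

lemma exists_sorted_quadruple {n : ℕ} {X : Finset (Fin n)} (h : X.card = 4) :
    ∃ x y z t, x < y ∧ y < z ∧ z < t ∧ X = {x, y, z, t} := by
  refine ⟨X.orderEmbOfFin h 0, X.orderEmbOfFin h 1, X.orderEmbOfFin h 2, X.orderEmbOfFin h 3,
    by simp, by simp, by simp, ?_⟩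
  ext z
  have hz := Set.ext_iff.1 (X.range_orderEmbOfFin h) z
  rw [Set.mem_range, Finset.mem_coe] at hz
  rw [← hz]
  simp only [Fin.exists_fin_succ, Finset.mem_insert, Finset.mem_singleton, eq_comm (a := z)]
  simp

/-- The cutting diagonal joins the two vertices with `col = false`, namely `u y` or `x v`. The
triangle on `u v` is glued first, then the one on the other side of the diagonal. -/
lemma glue_square {n : ℕ} {a b u v : Fin n} {V X : Finset (Fin n)}
    {q q' : Fin n → ℕ} {col : Fin n → Bool} (huv : Consec V u v)
    (hX : ∀ x ∈ X, u < x ∧ x < v) (hcard : X.card = 2)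
    (hq : ∀ x, q' x = q x + if x = u ∨ x = v ∨ x ∈ X then 1 else 0)
    (hcol : ∀ y z, Consec (V ∪ X) y z → col y ≠ col z) :
    col u ≠ col v ∧
      (Triangulates a b V (fun x => (if col x then 1 else 2) * q x) →
        Triangulates a b (V ∪ X) (fun x => (if col x then 1 else 2) * q' x)) := by
  obtain ⟨x, y, hxy, rfl⟩ := exists_sorted_pair hcard
  have hx := hX x (by simp)
  have hy := hX y (by simp)
  obtain ⟨hu, hv, huvlt, hcon⟩ := huv
  have c1 : col u ≠ col x := hcol u x (by
    refine ⟨by simp [hu], by simp, hx.1, ?_⟩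
    grind)
  have c2 : col x ≠ col y := hcol x y (by
    refine ⟨by simp, by simp, hxy, ?_⟩
    grind)
  have c3 : col y ≠ col v := hcol y v (by
    refine ⟨by simp, by simp [hv], hy.2, ?_⟩
    grind)
  refine ⟨?_, fun hT => ?_⟩
  · revert c1 c2 c3
    cases col u <;> cases col x <;> cases col y <;> cases col v <;> simp
  cases hc : col u
  · obtain ⟨h1, g1, g2⟩ := hT.insert ⟨hu, hv, huvlt, hcon⟩ hy
    obtain ⟨h2, -, -⟩ := h1.insert g1 ⟨hx.1, hxy⟩
    convert h2 using 1
    · grind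
    · funext z
      simp only [hq, Finset.mem_insert, Finset.mem_singleton]
      grind
  · obtain ⟨h1, g1, g2⟩ := hT.insert ⟨hu, hv, huvlt, hcon⟩ hx
    obtain ⟨h2, -, -⟩ := h1.insert g2 ⟨hxy, hy.2⟩
    convert h2 using 1
    · grind
    · funext z
      simp only [hq, Finset.mem_insert, Finset.mem_singleton]
      grind

/-- The inner triangle has the three vertices with `col = false`: `u y t` or `x s v`. The triangle
on `u v` is glued first, followed by the remaining three. -/
lemma glue_hexagon {n : ℕ} {a b u v : Fin n} {V X : Finset (Fin n)}
    {q q' : Fin n → ℕ} {col : Fin n → Bool} (huv : Consec V u v)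
    (hX : ∀ x ∈ X, u < x ∧ x < v) (hcard : X.card = 4)
    (hq : ∀ x, q' x = q x + if x = u ∨ x = v ∨ x ∈ X then 1 else 0)
    (hcol : ∀ y z, Consec (V ∪ X) y z → col y ≠ col z) :
    col u ≠ col v ∧
      (Triangulates a b V (fun x => (if col x then 1 else 3) * q x) →
        Triangulates a b (V ∪ X) (fun x => (if col x then 1 else 3) * q' x)) := by
  obtain ⟨x, y, s, t, hxy, hys, hst, rfl⟩ := exists_sorted_quadruple hcard
  have hx := hX x (by simp)
  have hy := hX y (by simp)
  have hs := hX s (by simp)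
  have ht := hX t (by simp)
  obtain ⟨hu, hv, huvlt, hcon⟩ := huv
  have c1 : col u ≠ col x := hcol u x (by
    refine ⟨by simp [hu], by simp, hx.1, ?_⟩
    grind)
  have c2 : col x ≠ col y := hcol x y (by
    refine ⟨by simp, by simp, hxy, ?_⟩
    grind)
  have c3 : col y ≠ col s := hcol y s (by
    refine ⟨by simp, by simp, hys, ?_⟩
    grind)
  have c4 : col s ≠ col t := hcol s t (by
    refine ⟨by simp, by simp, hst, ?_⟩
    grind)
  have c5 : col t ≠ col v := hcol t v (by
    refine ⟨by simp, by simp [hv], ht.2, ?_⟩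
    grind)
  refine ⟨?_, fun hT => ?_⟩
  · revert c1 c2 c3 c4 c5
    cases col u <;> cases col x <;> cases col y <;> cases col s <;> cases col t <;> cases col v <;>
      simp
  cases hc : col u
  · obtain ⟨h1, g1, g2⟩ := hT.insert ⟨hu, hv, huvlt, hcon⟩ ht
    obtain ⟨h2, k1, k2⟩ := h1.insert g1 ⟨hy.1, hys.trans hst⟩
    obtain ⟨h3, k3, k4⟩ := h2.insert k1 ⟨hx.1, hxy⟩
    obtain ⟨h4, -, -⟩ := h3.insert (u := y) (v := t) (x := s)
      (((consec_union_singleton k1 ⟨hx.1, hxy⟩ _ _).2 (Or.inr (Or.inr ⟨k2, by grind⟩))))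
      ⟨hys, hst⟩
    convert h4 using 1
    · grind
    · funext z
      simp only [hq, Finset.mem_insert, Finset.mem_singleton]
      grind
  · obtain ⟨h1, g1, g2⟩ := hT.insert ⟨hu, hv, huvlt, hcon⟩ hx
    obtain ⟨h2, k1, k2⟩ := h1.insert g2 ⟨hxy.trans hys, hs.2⟩
    obtain ⟨h3, k3, k4⟩ := h2.insert k2 ⟨hst, ht.2⟩
    obtain ⟨h4, -, -⟩ := h3.insert (u := x) (v := s) (x := y)
      (((consec_union_singleton k2 ⟨hst, ht.2⟩ _ _).2 (Or.inr (Or.inr ⟨k1, by grind⟩))))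
      ⟨hxy, hys⟩
    convert h4 using 1
    · grind
    · funext z
      simp only [hq, Finset.mem_insert, Finset.mem_singleton]
      grind

/-- Refining a quadrangulation or hexangulation of an alternately coloured polygon to a
triangulation. -/
theorem Glued.triangulates {p m : ℕ} (hp : (p = 4 ∧ m = 2) ∨ (p = 6 ∧ m = 3)) {n : ℕ} {a b : Fin n}
    {V : Finset (Fin n)} {D : Finset (Fin n × Fin n)} {q : Fin n → ℕ} {col : Fin n → Bool}
    (h : Glued p a b V D q) (hcol : ∀ y z, Consec V y z → col y ≠ col z) :
    Triangulates a b V (fun x => (if col x then 1 else m) * q x) := by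
  induction h with
  | edge h => exact ⟨_, by simpa using Glued.edge h⟩
  | @glue V X D q q' u v hG huv hX hcard hq ih =>
    -- The edge `u v` is outer for `V` but not for `V ∪ X`; that its ends differ in colour comes
    -- from the even length of the new cell.
    have hcolV : col u ≠ col v → ∀ y z, Consec V y z → col y ≠ col z := by
      intro hne y z hyz
      by_cases h : y = u ∧ z = v
      · rw [h.1, h.2]
        exact hne
      · exact hcol y z (huv.union_of_ne hX hyz h)
    rcases hp with ⟨rfl, rfl⟩ | ⟨rfl, rfl⟩
    · obtain ⟨h1, h2⟩ := glue_square (a := a) (b := b) huv hX (by omega) hq hcol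
      exact h2 (ih (hcolV h1))
    · obtain ⟨h1, h2⟩ := glue_hexagon (a := a) (b := b) huv hX (by omega) hq hcol
      exact h2 (ih (hcolV h1))

/-- Each gluing adds `p - 2` vertices. The parity of `n` makes the alternating colouring consistent
around the polygon. -/
lemma Glued.even_card {p : ℕ} (hp : Even p) {n : ℕ} {a b : Fin n}
    {V : Finset (Fin n)} {D : Finset (Fin n × Fin n)} {q : Fin n → ℕ}
    (h : Glued p a b V D q) : Even V.card := by
  induction h with
  | edge h => rw [Finset.card_pair h.ne]; exact even_two
  | @glue V X D q q' u v hG huv hX hcard hq ih =>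
    rw [Finset.card_union_of_disjoint]
    · have : Even X.card := by
        rw [← hcard] at hp
        exact (Nat.even_add.1 hp).2 even_two
      exact ih.add this
    · rw [Finset.disjoint_left]
      intro x hxV hx
      rcases huv.2.2.2 x hxV with h' | h'
      · exact absurd (hX x hx).1 (not_lt.2 h')
      · exact absurd (hX x hx).2 (not_lt.2 h')

/-! ### Friezes as determinants of antiperiodic sequences. -/

/-- A bi-infinite sequence of plane vectors that gives the frieze of a triangulation of the
`w + 3`-gon by taking determinants. -/
structure IsFriezeSequence (w : ℕ) (W : ℤ → ℤ × ℤ) : Prop where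
  antiperiodic : ∀ i, W (i + (w + 3)) = - W i
  succ : ∀ i, pdet (W i) (W (i + 1)) = 1
  pos : ∀ i j : ℤ, i < j → j < i + (w + 3) → 0 < pdet (W i) (W j)

/-- The determinants of a frieze sequence. -/
def sequenceFrieze (W : ℤ → ℤ × ℤ) (k : ℕ) (i : ℤ) : ℤ := pdet (W (i - 1)) (W (i - 1 + k))

lemma pdet_neg_right (x y : ℤ × ℤ) : pdet x (-y) = pdet y x := by
  simp only [pdet, Prod.fst_neg, Prod.snd_neg]; ring

/-- The diamond rule is the Plücker relation for `W (i - 1)`, `W i`, `W (i + k)`, `W (i + k + 1)`;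
antiperiodicity gives the two top rows. -/
lemma IsFriezeSequence.isFrieze {w : ℕ} {W : ℤ → ℤ × ℤ} (h : IsFriezeSequence w W) :
    IsFrieze w (fun k i => (sequenceFrieze W k i : ℝ)) := by
  refine ⟨?_, ?_, ?_, ?_, ?_, ?_⟩
  · intro i
    simp [sequenceFrieze, pdet_self]
  · intro i
    have := h.succ (i - 1)
    simp only [sequenceFrieze, Nat.cast_one]
    rw [this, Int.cast_one]
  · intro i
    have h1 := h.succ (i - 2)
    have h2 := h.antiperiodic (i - 2)
    have e : i - 1 + ((w + 2 : ℕ) : ℤ) = i - 2 + (w + 3) := by push_cast; ring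
    have e' : i - 2 + 1 = i - 1 := by ring
    simp only [sequenceFrieze]
    rw [e, h2, pdet_neg_right, ← e', h1]
    simp
  · intro i
    have h2 := h.antiperiodic (i - 1)
    have e : i - 1 + ((w + 3 : ℕ) : ℤ) = i - 1 + (w + 3) := by push_cast; ring
    simp only [sequenceFrieze]
    rw [e, h2, pdet_neg_right, pdet_self]
    simp
  · intro k hk hkw i
    simp only [sequenceFrieze]
    exact_mod_cast h.pos (i - 1) (i - 1 + k) (by omega) (by omega)
  · intro k _ i
    have h1 := h.succ (i - 1)
    have h2 := h.succ (i + k)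
    have e1 : i - 1 + ((k + 1 : ℕ) : ℤ) = i + k := by push_cast; ring
    have e2 : i + 1 - 1 + ((k + 1 : ℕ) : ℤ) = i + k + 1 := by push_cast; ring
    have e3 : i - 1 + ((k + 2 : ℕ) : ℤ) = i + k + 1 := by push_cast; ring
    have e4 : i + 1 - 1 + (k : ℤ) = i + k := by ring
    have e5 : i + 1 - 1 = i := by ring
    have e6 : i - 1 + 1 = i := by ring
    simp only [sequenceFrieze]
    rw [e1, e2, e3, e4, e5]
    rw [e6] at h1
    have : pdet (W (i - 1)) (W (i + k)) * pdet (W i) (W (i + k + 1)) -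
        pdet (W (i - 1)) (W (i + k + 1)) * pdet (W i) (W (i + k)) =
        pdet (W (i - 1)) (W i) * pdet (W (i + k)) (W (i + k + 1)) := by
      simp only [pdet]; ring
    rw [h1, h2] at this
    exact_mod_cast this

/-- The antiperiodic extension of finitely many vectors. -/
noncomputable def antiperiodicExtension {w : ℕ} (v : Fin (w + 3) → ℤ × ℤ) (i : ℤ) : ℤ × ℤ :=
  ((i / (w + 3)).negOnePow : ℤ) •
    v ⟨(i % (w + 3)).toNat, by
      have := Int.emod_lt_of_pos i (by positivity : (0 : ℤ) < (w : ℤ) + 3)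
      have := Int.emod_nonneg i (by positivity : (w : ℤ) + 3 ≠ 0)
      omega⟩

lemma antiperiodicExtension_apply {w : ℕ} (v : Fin (w + 3) → ℤ × ℤ) (x : Fin (w + 3)) (r : ℤ) :
    antiperiodicExtension v (x.val + r * (w + 3)) = (r.negOnePow : ℤ) • v x := by
  have h0 : (w : ℤ) + 3 ≠ 0 := by positivity
  have hx : (x.val : ℤ) < w + 3 := by have := x.isLt; omega
  have h1 : ((x.val : ℤ) + r * (w + 3)) / (w + 3) = r := by
    rw [Int.add_mul_ediv_right _ _ h0, Int.ediv_eq_zero_of_lt (by positivity) hx, zero_add]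
  have h2 : ((x.val : ℤ) + r * (w + 3)) % (w + 3) = x.val := by
    rw [Int.add_mul_emod_self_right, Int.emod_eq_of_lt (by positivity) hx]
  unfold antiperiodicExtension
  simp only [h1, h2, Int.toNat_natCast]

lemma exists_eq_add_mul (w : ℕ) (i : ℤ) :
    ∃ (x : Fin (w + 3)) (r : ℤ), i = x.val + r * ((w : ℤ) + 3) := by
  have h1 := Int.emod_lt_of_pos i (by positivity : (0 : ℤ) < (w : ℤ) + 3)
  have h2 := Int.emod_nonneg i (by positivity : (w : ℤ) + 3 ≠ 0)
  refine ⟨⟨(i % (w + 3)).toNat, by omega⟩, i / (w + 3), ?_⟩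
  have := Int.emod_add_mul_ediv i (w + 3)
  simp only [Int.toNat_of_nonneg h2]
  linarith

lemma pdet_smul (r s : ℤ) (x y : ℤ × ℤ) : pdet (r • x) (s • y) = r * s * pdet x y := by
  simp only [pdet, Prod.smul_fst, Prod.smul_snd, smul_eq_mul]; ring

lemma IsLabelling.isFriezeSequence {w : ℕ} {T : Finset (Fin (w + 3) × Fin (w + 3))}
    {q : Fin (w + 3) → ℕ} {v : Fin (w + 3) → ℤ × ℤ}
    (h : IsLabelling 0 (Fin.last (w + 2)) Finset.univ T q v) :
    IsFriezeSequence w (antiperiodicExtension v) := by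
  have hpos : ∀ i j : ℤ, i < j → j < i + (w + 3) →
      0 < pdet (antiperiodicExtension v i) (antiperiodicExtension v j) := by
    intro i j hij hji
    obtain ⟨x, r, rfl⟩ := exists_eq_add_mul w i
    obtain ⟨y, s, rfl⟩ := exists_eq_add_mul w j
    rw [antiperiodicExtension_apply, antiperiodicExtension_apply, pdet_smul]
    have hx := x.isLt
    have hy := y.isLt
    have hrs : r ≤ s := by
      by_contra hlt
      nlinarith
    have hsr : s ≤ r + 1 := by
      by_contra hlt
      nlinarith
    -- The vectors lie in the same period or in successive ones; in the second case the sign from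
    -- antiperiodicity undoes the reversed order of the vertices.
    rcases (by omega : s = r ∨ s = r + 1) with rfl | rfl
    · rw [Int.units_coe_mul_self, one_mul]
      exact h.pos x (Finset.mem_univ _) y (Finset.mem_univ _) (by rw [Fin.lt_def]; omega)
    · rw [Int.negOnePow_succ, Units.val_neg, mul_neg, Int.units_coe_mul_self]
      have := h.pos y (Finset.mem_univ _) x (Finset.mem_univ _)
        (by rw [Fin.lt_def]; nlinarith)
      simp only [pdet] at this ⊢
      linarith
  have hsucc : ∀ i, pdet (antiperiodicExtension v i) (antiperiodicExtension v (i + 1)) = 1 := by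
    intro i
    obtain ⟨x, r, rfl⟩ := exists_eq_add_mul w i
    have hx := x.isLt
    by_cases hlast : x.val = w + 2
    · have e : (x.val : ℤ) + r * (w + 3) + 1 = ((0 : Fin (w + 3)).val : ℤ) + (r + 1) * (w + 3) := by
        rw [hlast]; push_cast; ring_nf; simp
      rw [e, antiperiodicExtension_apply, antiperiodicExtension_apply, pdet_smul,
        Int.negOnePow_succ, Units.val_neg, mul_neg, Int.units_coe_mul_self]
      have := h.outer
      have hx' : x = Fin.last (w + 2) := Fin.ext hlast
      rw [hx']
      simp only [pdet] at this ⊢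
      linarith
    · have e : (x.val : ℤ) + r * (w + 3) + 1 =
          ((⟨x.val + 1, by omega⟩ : Fin (w + 3)).val : ℤ) + r * (w + 3) := by
        push_cast; ring
      rw [e, antiperiodicExtension_apply, antiperiodicExtension_apply, pdet_smul,
        Int.units_coe_mul_self, one_mul]
      exact (h.eq_one_iff _ (Finset.mem_univ _) _ (Finset.mem_univ _)
        (by rw [Fin.lt_def]; simp)).2 (Or.inl (consec_univ.2 rfl))
  refine ⟨fun i => ?_, hsucc, hpos⟩
  obtain ⟨x, r, rfl⟩ := exists_eq_add_mul w i
  have e : (x.val : ℤ) + r * (w + 3) + (w + 3) = x.val + (r + 1) * (w + 3) := by ring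
  rw [e, antiperiodicExtension_apply, antiperiodicExtension_apply, Int.negOnePow_succ,
    Units.val_neg, neg_smul]

/-- At `0` and at the last vertex one neighbour lies in an adjacent period, which accounts for the
minus signs in `first` and `last`. -/
lemma IsLabelling.add_eq_smul {w : ℕ} {T : Finset (Fin (w + 3) × Fin (w + 3))}
    {q : Fin (w + 3) → ℕ} {v : Fin (w + 3) → ℤ × ℤ}
    (h : IsLabelling 0 (Fin.last (w + 2)) Finset.univ T q v) (x : Fin (w + 3)) (r : ℤ) :
    antiperiodicExtension v (x.val + r * (w + 3) - 1) +
      antiperiodicExtension v (x.val + r * (w + 3) + 1) =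
        (q x : ℤ) • antiperiodicExtension v (x.val + r * (w + 3)) := by
  have hx := x.isLt
  have hup : ∀ (hlt : x.val < w + 2), (x.val : ℤ) + r * (w + 3) + 1 =
      ((⟨x.val + 1, by omega⟩ : Fin (w + 3)).val : ℤ) + r * (w + 3) := by
    intro _; push_cast; ring
  have hdown : ∀ (hlt : 0 < x.val), (x.val : ℤ) + r * (w + 3) - 1 =
      ((⟨x.val - 1, by omega⟩ : Fin (w + 3)).val : ℤ) + r * (w + 3) := by
    intro _; simp only; omega
  by_cases h0 : x.val = 0
  · have hx0 : x = 0 := Fin.ext h0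
    have e : (x.val : ℤ) + r * (w + 3) - 1 =
        ((Fin.last (w + 2)).val : ℤ) + (r - 1) * (w + 3) := by
      rw [h0, Fin.val_last]; push_cast; ring
    have hr : ((r - 1).negOnePow : ℤ) = - (r.negOnePow : ℤ) := by
      rw [Int.negOnePow_sub, Int.negOnePow_one]; simp
    rw [e, hup (by omega), antiperiodicExtension_apply, antiperiodicExtension_apply,
      antiperiodicExtension_apply, hr]
    have := h.first ⟨x.val + 1, by omega⟩ (consec_univ.2 (by simp [h0]))
    rw [← hx0] at this
    rw [smul_comm, ← this, smul_sub, neg_smul]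
    abel
  · by_cases hlast : x.val = w + 2
    · have hxl : x = Fin.last (w + 2) := Fin.ext hlast
      have e : (x.val : ℤ) + r * (w + 3) + 1 = ((0 : Fin (w + 3)).val : ℤ) + (r + 1) * (w + 3) := by
        rw [hlast]; push_cast; ring_nf; simp
      rw [e, hdown (by omega), antiperiodicExtension_apply, antiperiodicExtension_apply,
        antiperiodicExtension_apply, Int.negOnePow_succ, Units.val_neg]
      have := h.last ⟨x.val - 1, by omega⟩ (consec_univ.2 (by simp only [Fin.val_last]; omega))
      rw [← hxl] at this
      rw [smul_comm, ← this, smul_sub, neg_smul]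
      abel
    · rw [hup (by omega), hdown (by omega), antiperiodicExtension_apply,
        antiperiodicExtension_apply, antiperiodicExtension_apply, smul_comm,
        ← h.add ⟨x.val - 1, by omega⟩ x ⟨x.val + 1, by omega⟩
          (consec_univ.2 (by simp only; omega)) (consec_univ.2 rfl), smul_add]

/-- The Conway-Coxeter frieze of a triangulation, with the properties that are used. -/
theorem IsTriangulation.exists_sequence {w : ℕ} {T : Finset (Fin (w + 3) × Fin (w + 3))}
    (hT : IsTriangulation T) :
    ∃ (W : ℤ → ℤ × ℤ) (q : Fin (w + 3) → ℕ), IsFriezeSequence w W ∧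
      (∀ x, quiddity T x = q x) ∧ (∃ x, q x = 1) ∧
      (∀ (x : Fin (w + 3)) (r : ℤ), W (x.val + r * (w + 3) - 1) + W (x.val + r * (w + 3) + 1) =
        (q x : ℤ) • W (x.val + r * (w + 3))) ∧
      ∀ x y : Fin (w + 3), (x, y) ∈ T ↔
        IsDiagonal (x, y) ∧ pdet (W x.val) (W y.val) = 1 := by
  obtain ⟨q, hG, hq⟩ := IsAngulation.glued hT
  obtain ⟨v, hv⟩ := hG.exists_isLabelling
  have hlam : lam 3 = 1 := by simp [lam]
  refine ⟨_, q, hv.isFriezeSequence, fun x => by rw [hq, hlam, one_mul],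
    hG.exists_eq_one (by simp), hv.add_eq_smul, fun x y => ?_⟩
  have hW : ∀ x : Fin (w + 3), antiperiodicExtension v x.val = v x := by
    intro x
    have := antiperiodicExtension_apply v x 0
    simpa using this
  rw [hW, hW]
  constructor
  · intro h
    have hd := hT.1.1 _ h
    refine ⟨hd, (hv.eq_one_iff x (Finset.mem_univ _) y (Finset.mem_univ _) ?_).2
      (Or.inr (Finset.mem_insert_of_mem h))⟩
    rw [Fin.lt_def]
    exact lt_trans (Nat.lt_succ_self _) hd.1
  · rintro ⟨hd, h⟩
    have hlt : x < y := by
      rw [Fin.lt_def]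
      exact lt_trans (Nat.lt_succ_self _) hd.1
    rcases (hv.eq_one_iff x (Finset.mem_univ _) y (Finset.mem_univ _) hlt).1 h with h | h
    · exact absurd (consec_univ.1 h) hd.1.ne
    · rcases Finset.mem_insert.1 h with h | h
      · obtain ⟨rfl, rfl⟩ := Prod.ext_iff.1 h
        exact absurd ⟨rfl, rfl⟩ hd.2
      · exact h

lemma sequenceFrieze_zero (W : ℤ → ℤ × ℤ) (i : ℤ) : sequenceFrieze W 0 i = 0 := by
  simp [sequenceFrieze, pdet_self]

lemma sequenceFrieze_add_two {W : ℤ → ℤ × ℤ} {a i : ℤ} {k : ℕ}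
    (h : W (i + k - 1) + W (i + k + 1) = a • W (i + k)) :
    sequenceFrieze W (k + 2) i = a * sequenceFrieze W (k + 1) i - sequenceFrieze W k i := by
  have e1 : i - 1 + ((k + 2 : ℕ) : ℤ) = i + k + 1 := by push_cast; ring
  have e2 : i - 1 + ((k + 1 : ℕ) : ℤ) = i + k := by push_cast; ring
  have e3 : i - 1 + (k : ℤ) = i + k - 1 := by ring
  simp only [sequenceFrieze]
  rw [e1, e2, e3, eq_sub_of_add_eq' h]
  simp only [pdet, Prod.fst_sub, Prod.snd_sub, Prod.smul_fst, Prod.smul_snd, smul_eq_mul]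
  ring

/-- The frieze of a triangulation is the frieze of a sequence of integral vectors. -/
theorem IsTriangulation.exists_frieze {w : ℕ} {T : Finset (Fin (w + 3) × Fin (w + 3))}
    (hT : IsTriangulation T) :
    ∃ (W : ℤ → ℤ × ℤ) (q : Fin (w + 3) → ℕ), IsFriezeSequence w W ∧
      IsFriezeOf T (fun k i => (sequenceFrieze W k i : ℝ)) ∧
      (∀ x, quiddity T x = q x) ∧ (∃ x, q x = 1) ∧
      (∀ (x : Fin (w + 3)) (r : ℤ), W (x.val + r * (w + 3) - 1) + W (x.val + r * (w + 3) + 1) =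
        (q x : ℤ) • W (x.val + r * (w + 3))) ∧
      ∀ x y : Fin (w + 3), (x, y) ∈ T ↔
        IsDiagonal (x, y) ∧ pdet (W x.val) (W y.val) = 1 := by
  obtain ⟨W, q, hW, hq, h1, hadd, hmem⟩ := hT.exists_sequence
  refine ⟨W, q, hW, ⟨hW.isFrieze, fun x r => ?_⟩, hq, h1, hadd, hmem⟩
  have h := sequenceFrieze_add_two (k := 0) (W := W) (i := x.val + r * (w + 3))
    (a := q x) (by rw [Nat.cast_zero, add_zero]; exact hadd x r)
  have h2 := hW.isFrieze.row_one (x.val + r * (w + 3))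
  simp only [zero_add, sequenceFrieze_zero, sub_zero] at h
  simp only [h, hq, Int.cast_mul, h2, Int.cast_natCast, mul_one]

/-! ### Friezes and triangulations determined by their quiddity. -/

/-- The diamond rule gives the top entry as soon as the bottom one is nonzero. Row 2 must be given,
since below it the bottom entry is 0. -/
lemma IsFrieze.eq_of_row_two {w : ℕ} {F G : ℕ → ℤ → ℝ} (hF : IsFrieze w F) (hG : IsFrieze w G)
    (h : ∀ i, F 2 i = G 2 i) : ∀ k, k ≤ w + 3 → ∀ i, F k i = G k i := by
  have key : ∀ k, k ≤ w + 2 → ∀ i, F k i = G k i ∧ F (k + 1) i = G (k + 1) i := by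
    intro k
    induction k with
    | zero => exact fun _ i => ⟨by rw [hF.row_zero, hG.row_zero], by rw [hF.row_one, hG.row_one]⟩
    | succ k ih =>
      intro hk i
      have ih := ih (by omega)
      refine ⟨(ih i).2, ?_⟩
      rcases Nat.eq_zero_or_pos k with rfl | hk0
      · exact h i
      · have hpos : 0 < G k (i + 1) := by
          rcases (by omega : k = 1 ∨ 2 ≤ k) with rfl | h2
          · rw [hG.row_one]
            exact one_pos
          · exact hG.pos k h2 (by omega) _
        have h1 := hF.diamond k (by omega) i
        have h2 := hG.diamond k (by omega) i
        rw [(ih i).2, (ih (i + 1)).2, (ih (i + 1)).1] at h1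
        exact mul_right_cancel₀ hpos.ne' (by linarith)
  intro k hk i
  rcases k with _ | k
  · exact (key 0 (by omega) i).1
  · exact (key k (by omega) i).2

lemma IsFriezeOf.eq_of_quiddity {w : ℕ} {D D' : Finset (Fin (w + 3) × Fin (w + 3))}
    {F G : ℕ → ℤ → ℝ} (hF : IsFriezeOf D F) (hG : IsFriezeOf D' G)
    (h : ∀ x, quiddity D x = quiddity D' x) : ∀ k, k ≤ w + 3 → ∀ i, F k i = G k i := by
  refine hF.1.eq_of_row_two hG.1 fun i => ?_
  obtain ⟨x, r, rfl⟩ := exists_eq_add_mul w i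
  rw [hF.2, hG.2, h]

lemma IsFriezeOf.two {w : ℕ} {D : Finset (Fin (w + 3) × Fin (w + 3))}
    {F : ℕ → ℤ → ℝ} (hF : IsFriezeOf D F) (x : Fin (w + 3)) : F 2 x.val = quiddity D x := by
  simpa using hF.2 x 0

/-- A triangulation is determined by the numbers of triangles at the vertices. -/
theorem IsTriangulation.eq_of_quiddity {w : ℕ} {T T' : Finset (Fin (w + 3) × Fin (w + 3))}
    (hT : IsTriangulation T) (hT' : IsTriangulation T')
    (h : ∀ x, quiddity T x = quiddity T' x) : T = T' := by
  obtain ⟨W, -, -, hF, -, -, -, hmem⟩ := hT.exists_frieze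
  obtain ⟨W', -, -, hF', -, -, -, hmem'⟩ := hT'.exists_frieze
  ext ⟨x, y⟩
  rw [hmem, hmem']
  refine and_congr_right fun hd => ?_
  have hlt : x.val < y.val := lt_trans (Nat.lt_succ_self _) hd.1
  -- Row `y - x` at position `x + 1` is the determinant of the vectors at `x` and `y`, which decides
  -- whether `(x, y)` is in the triangulation.
  have heq := hF.eq_of_quiddity hF' h (y.val - x.val) (by omega) (x.val + 1)
  have e : (x.val : ℤ) + ((y.val - x.val : ℕ) : ℤ) = y.val := by omega
  simp only [sequenceFrieze, add_sub_cancel_right, e, Int.cast_inj] at heq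
  rw [heq]

/-- Two steps up from an even row, the recursion uses the coefficient at `i + 2 * t`, a position of
the same parity as `i`, hence a multiple of `m`. -/
lemma dvd_sequenceFrieze {W : ℤ → ℤ × ℤ} {m c : ℤ}
    (h : ∀ i, ¬ i ≡ c [ZMOD 2] → ∃ a, m ∣ a ∧ W (i - 1) + W (i + 1) = a • W i) {i : ℤ}
    (hi : ¬ i ≡ c [ZMOD 2]) (t : ℕ) : m ∣ sequenceFrieze W (2 * t) i := by
  induction t with
  | zero => simp [sequenceFrieze_zero]
  | succ t ih =>
    obtain ⟨a, ha, hW⟩ := h (i + (2 * t : ℕ)) (by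
      unfold Int.ModEq at hi ⊢
      omega)
    rw [Nat.mul_succ, sequenceFrieze_add_two hW]
    exact dvd_sub (ha.mul_right _) ih

/-! ### Rescaling the even rows. -/

/-- Multiplying the even rows of a frieze of odd width alternately by `s` and `s⁻¹`. -/
noncomputable def rescale (s : ℝ) (c : ℤ) (G : ℕ → ℤ → ℝ) (k : ℕ) (i : ℤ) : ℝ :=
  if Even k then if i ≡ c [ZMOD 2] then s * G k i else G k i / s else G k i

/-- In each diamond the two entries from even rows are multiplied together and have positions of
opposite parity, so `s` and `s⁻¹` cancel. Odd width keeps the top row of ones among the odd rows. -/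
lemma IsFrieze.rescale {w : ℕ} (hw : Odd w) {s : ℝ} (hs : 0 < s) (c : ℤ) {G : ℕ → ℤ → ℝ}
    (hG : IsFrieze w G) : IsFrieze w (rescale s c G) := by
  have hsucc : ∀ i : ℤ, i + 1 ≡ c [ZMOD 2] ↔ ¬ i ≡ c [ZMOD 2] := by
    intro i
    unfold Int.ModEq
    omega
  refine ⟨?_, ?_, ?_, ?_, ?_, ?_⟩
  · intro i
    simp [_root_.rescale, hG.row_zero]
  · intro i
    simp [_root_.rescale, hG.row_one]
  · intro i
    have : ¬ Even (w + 2) := by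
      rw [Nat.not_even_iff_odd]
      exact hw.add_even even_two
    simp [_root_.rescale, hG.row_top_one, this]
  · intro i
    simp [_root_.rescale, hG.row_top_zero]
  · intro k h1 h2 i
    have := hG.pos k h1 h2 i
    unfold _root_.rescale
    split_ifs <;> positivity
  · intro k hk i
    have h := hG.diamond k hk i
    rw [← h]
    unfold _root_.rescale
    by_cases hk2 : Even k
    · have h1 : ¬ Even (k + 1) := by rw [Nat.even_add_one]; simpa using hk2
      have h2 : Even (k + 2) := hk2.add even_two
      by_cases hi : i ≡ c [ZMOD 2]
      · simp only [hk2, h1, h2, hi, hsucc, if_true, if_false, not_true]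
        field_simp
      · simp only [hk2, h1, h2, hi, hsucc, if_true, if_false, not_false_eq_true]
        field_simp
    · have h1 : Even (k + 1) := by rw [Nat.even_add_one]; exact hk2
      have h2 : ¬ Even (k + 2) := by rw [Nat.even_add_one]; simpa using h1
      by_cases hi : i ≡ c [ZMOD 2]
      · simp only [hk2, h1, h2, hi, hsucc, if_true, if_false, not_true]
        field_simp
      · simp only [hk2, h1, h2, hi, hsucc, if_true, if_false, not_false_eq_true]
        field_simp

lemma modEq_add_mul_iff {w : ℕ} (hw : Odd w) (x r c : ℤ) :
    x + r * ((w : ℤ) + 3) ≡ c [ZMOD 2] ↔ x ≡ c [ZMOD 2] := by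
  have h : x + r * ((w : ℤ) + 3) ≡ x [ZMOD 2] := by
    obtain ⟨t, rfl⟩ := hw
    refine (Int.modEq_iff_dvd.2 ⟨-(r * (t + 2)), ?_⟩)
    push_cast
    ring
  exact ⟨h.symm.trans, h.trans⟩

lemma lam_eq_sqrt {p m : ℕ} (hp : (p = 4 ∧ m = 2) ∨ (p = 6 ∧ m = 3)) : lam p = Real.sqrt m := by
  rcases hp with ⟨rfl, rfl⟩ | ⟨rfl, rfl⟩
  · simp only [lam, Nat.cast_ofNat, Real.cos_pi_div_four]
    ring
  · simp only [lam, Nat.cast_ofNat, Real.cos_pi_div_six]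
    ring

/-- The triangulation obtained from a `4`- or `6`-angulation and a colouring, and the friezes. -/
theorem exists_refinement {p m : ℕ} (hp : (p = 4 ∧ m = 2) ∨ (p = 6 ∧ m = 3)) {w : ℕ}
    (hw : Odd w) {D D' : Finset (Fin (w + 3) × Fin (w + 3))} {q : Fin (w + 3) → ℕ}
    (hG : Glued p 0 (Fin.last (w + 2)) Finset.univ D' q)
    (hq : ∀ x, quiddity D x = Real.sqrt m * q x) (c : ℤ) :
    ∃ T G F, IsTriangulation T ∧ IsFriezeOf T G ∧ IsFriezeOf D F ∧ CoincideInOddRows w F G ∧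
      EvenRowsRelated w m c F G ∧
      (∀ x : Fin (w + 3), (x.val : ℤ) ≡ c [ZMOD 2] → quiddity T x = q x) ∧
      (∀ x : Fin (w + 3), ¬ (x.val : ℤ) ≡ c [ZMOD 2] → quiddity T x = m * q x) ∧
      ∃ x : Fin (w + 3), (x.val : ℤ) ≡ c [ZMOD 2] ∧ q x = 1 := by
  have hm : 2 ≤ m := by omega
  set s := Real.sqrt m with hsdef
  have hs : 0 < s := Real.sqrt_pos.2 (by exact_mod_cast (by omega : 0 < m))
  have hss : s * s = m := Real.mul_self_sqrt (by positivity)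
  obtain ⟨T', hT'⟩ := hG.triangulates hp
    (col := fun x : Fin (w + 3) => decide ((x.val : ℤ) ≡ c [ZMOD 2])) (by
      intro y z hyz
      have := consec_univ.1 hyz
      intro h
      rw [decide_eq_decide] at h
      unfold Int.ModEq at h
      omega)
  obtain ⟨hT, hquid⟩ := hT'.isAngulation le_rfl
  obtain ⟨W, q', hW, hF, hq', ⟨x₁, hx₁⟩, hadd, -⟩ := IsTriangulation.exists_frieze hT
  have hqq : ∀ x : Fin (w + 3), q' x = (if (x.val : ℤ) ≡ c [ZMOD 2] then 1 else m) * q x := by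
    intro x
    have h := hquid x
    rw [hq' x, show lam 3 = 1 by simp [lam], one_mul] at h
    simpa using Nat.cast_injective h
  have hdvd : ∀ i, ¬ i ≡ c [ZMOD 2] → ∀ k, Even k → (m : ℤ) ∣ sequenceFrieze W k i := by
    intro i hi k hk
    obtain ⟨t, rfl⟩ := hk.two_dvd
    refine dvd_sequenceFrieze (c := c) (fun j hj => ?_) hi t
    obtain ⟨x, r, rfl⟩ := exists_eq_add_mul w j
    refine ⟨q' x, ?_, hadd x r⟩
    rw [modEq_add_mul_iff hw] at hj
    rw [hqq, if_neg hj]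
    push_cast
    exact dvd_mul_right _ _
  have hpos : ∀ k, 2 ≤ k → k ≤ w + 1 → ∀ i, 0 < sequenceFrieze W k i := by
    intro k h1 h2 i
    exact_mod_cast hF.1.pos k h1 h2 i
  refine ⟨_, _, rescale s c (fun k i => (sequenceFrieze W k i : ℝ)), hT, hF,
    ⟨hF.1.rescale hw hs c, fun x r => ?_⟩, ?_, ?_, ?_, ?_, x₁, ?_⟩
  · have h := hF.2 x r
    rw [hq', hqq] at h
    rw [hq]
    unfold rescale
    rw [if_pos even_two]
    simp only [modEq_add_mul_iff hw]
    split_ifs with hx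
    · simp only [h, if_pos hx, one_mul]
    · simp only [h, if_neg hx]
      push_cast
      rw [← hss]
      field_simp
  · intro k _ hk i
    unfold rescale
    rw [if_neg (Nat.not_even_iff_odd.2 hk)]
  · intro k h1 h2 hk i
    have hp0 := hpos k h1 h2 i
    unfold rescale
    rw [if_pos hk]
    by_cases hi : i ≡ c [ZMOD 2]
    · obtain ⟨a, ha⟩ := Int.eq_ofNat_of_zero_le hp0.le
      refine ⟨a, by omega, ?_, fun _ => ?_, fun h => absurd hi h⟩
      · simp only [if_pos hi, ha, Int.cast_natCast, ← hsdef]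
      · simp only [ha, Int.cast_natCast]
    · obtain ⟨b, hb⟩ := hdvd i hi k hk
      have hb0 : 0 < b := by
        by_contra hle
        have : (m : ℤ) * b ≤ 0 := mul_nonpos_of_nonneg_of_nonpos (by positivity) (not_lt.1 hle)
        omega
      obtain ⟨a, rfl⟩ := Int.eq_ofNat_of_zero_le hb0.le
      refine ⟨a, by omega, ?_, fun h => absurd h hi, fun _ => ?_⟩
      · simp only [if_neg hi, hb]
        push_cast
        rw [← hsdef, ← hss]
        field_simp
      · simp only [hb]
        push_cast
        rfl
  · intro x hx
    rw [hq', hqq, if_pos hx, one_mul]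
  · intro x hx
    rw [hq', hqq, if_neg hx]
    push_cast
    rfl
  -- The count 1 at an ear is not a multiple of `m ≥ 2`, so the ear has class `c` and lies in a
  -- single `p`-gon.
  · rw [hqq] at hx₁
    split_ifs at hx₁ with h
    · exact ⟨h, by simpa using hx₁⟩
    · have := Nat.eq_one_of_mul_eq_one_right hx₁
      omega

/-! ### Comparison of row 2 and the main theorem. -/

/-- Rows number 2 of friezes that coincide in row number 3 are proportional, alternately with
a factor and its inverse. -/
lemma IsFrieze.row_two_alternates {w : ℕ} {F G : ℕ → ℤ → ℝ} (hF : IsFrieze w F)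
    (hG : IsFrieze w G) (hw : 1 ≤ w) (h : ∀ i, F 3 i = G 3 i) (i j : ℤ) :
    (i ≡ j [ZMOD 2] → G 2 i * F 2 j = G 2 j * F 2 i) ∧
      (¬ i ≡ j [ZMOD 2] → G 2 i * G 2 j = F 2 i * F 2 j) := by
  have hFp : ∀ i, F 2 i ≠ 0 := fun i => (hF.pos 2 le_rfl (by omega) i).ne'
  have hGp : ∀ i, G 2 i ≠ 0 := fun i => (hG.pos 2 le_rfl (by omega) i).ne'
  -- With ones in row 1, the diamond rule says that an entry of row 3 is a product of neighbours in
  -- row 2, minus 1.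
  have hprod : ∀ i, G 2 i * G 2 (i + 1) = F 2 i * F 2 (i + 1) := by
    intro i
    have h1 := hF.diamond 1 (by omega) i
    have h2 := hG.diamond 1 (by omega) i
    rw [hF.row_one] at h1
    rw [hG.row_one] at h2
    have := h i
    norm_num at h1 h2
    linarith
  -- The ratios at neighbouring positions are inverse to each other, so they repeat with period 2.
  have hper : Function.Periodic (fun i => G 2 i / F 2 i) (2 : ℤ) := by
    intro i
    have h1 := hprod i
    have h2 := hprod (i + 1)
    rw [show i + 1 + 1 = i + 2 by ring] at h2
    have e1 := hFp i
    have e2 := hFp (i + 2)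
    simp only
    rw [div_eq_div_iff e2 e1]
    refine mul_left_cancel₀ (mul_ne_zero (hGp (i + 1)) (hFp (i + 1))) ?_
    linear_combination F 2 i * F 2 (i + 1) * h2 - F 2 (i + 1) * F 2 (i + 2) * h1
  have hsame : ∀ i j : ℤ, i ≡ j [ZMOD 2] → G 2 i * F 2 j = G 2 j * F 2 i := by
    intro i j hij
    obtain ⟨t, ht⟩ := Int.modEq_iff_dvd.1 hij
    have := (hper.int_mul t) i
    rw [Int.cast_id, show i + t * 2 = j by linarith, div_eq_div_iff (hFp j) (hFp i)] at this
    exact this.symm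
  refine ⟨hsame i j, fun hij => ?_⟩
  have h1 := hsame j (i + 1) (by unfold Int.ModEq at hij ⊢; omega)
  have h2 := hprod i
  refine mul_right_cancel₀ (hFp (i + 1)) ?_
  linear_combination G 2 i * h1 + F 2 j * h2

theorem mainTheorem1 (p m : ℕ) (hp : (p = 4 ∧ m = 2) ∨ (p = 6 ∧ m = 3)) (w : ℕ)
    (D : Finset (Fin (w + 3) × Fin (w + 3))) (hD : IsAngulation p D) :
    (∃ F, IsFriezeOf D F) ∧
    ∀ F, IsFriezeOf D F →
      (∀ c : ℤ, ∃! T : Finset (Fin (w + 3) × Fin (w + 3)), IsTriangulation T ∧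
        ∃ G, IsFriezeOf T G ∧ CoincideInOddRows w F G ∧ EvenRowsRelated w m c F G) ∧
      (∀ T : Finset (Fin (w + 3) × Fin (w + 3)), IsTriangulation T →
        ∀ G, IsFriezeOf T G → CoincideInOddRows w F G →
          ∃ c : ℤ, EvenRowsRelated w m c F G) := by
  obtain ⟨q, hglued, hq⟩ := hD.glued
  rw [lam_eq_sqrt hp] at hq
  have hw : Odd w := by
    have h := hglued.even_card (by rcases hp with ⟨rfl, -⟩ | ⟨rfl, -⟩ <;> decide)
    rw [Finset.card_univ, Fintype.card_fin] at h
    rw [← Nat.not_even_iff_odd]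
    rintro ⟨r, rfl⟩
    obtain ⟨t, ht⟩ := h
    omega
  have hw1 : 1 ≤ w := hw.pos
  have hs : 0 < Real.sqrt m :=
    Real.sqrt_pos.2 (by exact_mod_cast (by omega : 0 < m))
  have hss : Real.sqrt m * Real.sqrt m = m := Real.mul_self_sqrt (by positivity)
  have href := exists_refinement hp hw hglued hq
  refine ⟨?_, fun F hF => ⟨fun c => ?_, fun T hT G hG hodd => ?_⟩⟩
  · obtain ⟨-, -, F, -, -, hF, -⟩ := href 0
    exact ⟨F, hF⟩
  · obtain ⟨T, G, F', hT, hG, hF', hodd, heven, -⟩ := href c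
    have hFF' := hF.eq_of_quiddity hF' (fun _ => rfl)
    have heven' : EvenRowsRelated w m c F G := by
      intro k h1 h2 hk i
      rw [hFF' k (by omega) i]
      exact heven k h1 h2 hk i
    refine ⟨T, ⟨hT, G, hG, fun k h1 hk i => (hFF' k h1 i).trans (hodd k h1 hk i), heven'⟩, ?_⟩
    rintro T₁ ⟨hT₁, G₁, hG₁, -, heven₁⟩
    refine hT₁.eq_of_quiddity hT fun x => ?_
    rw [← hG₁.two, ← hG.two]
    obtain ⟨a, -, ha, ha1, ha2⟩ := heven' 2 le_rfl (by omega) even_two x.val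
    obtain ⟨b, -, hb, hb1, hb2⟩ := heven₁ 2 le_rfl (by omega) even_two x.val
    have hab : (a : ℝ) = b := mul_left_cancel₀ hs.ne' (ha.symm.trans hb)
    by_cases hx : (x.val : ℤ) ≡ c [ZMOD 2]
    · rw [ha1 hx, hb1 hx, hab]
    · rw [ha2 hx, hb2 hx, hab]
  · obtain ⟨-, qT, -, -, hqT, ⟨β, hβ⟩, -⟩ := hT.exists_frieze
    -- The class `c` is that of an ear `β` of `T`; the refinement `T'` for this class has an ear
    -- `x₀` in it with `q x₀ = 1`.
    obtain ⟨T', G', F', hT', hG', hF', -, heven, hsame, hdiff, x₀, hx₀, hqx₀⟩ := href β.val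
    have halt := hF.1.row_two_alternates hG.1 hw1
      (fun i => hodd 3 (by omega) (by decide) i)
    -- Proportionality within the class gives `qT x₀ * q β = qT β * q x₀ = 1` in natural numbers.
    have hβ1 : q β = 1 := by
      have h := (halt x₀.val β.val).1 hx₀
      rw [hG.two, hG.two, hF.two, hF.two, hq, hq, hqT, hqT, hβ, hqx₀] at h
      have h' : ((qT x₀ * q β : ℕ) : ℝ) = (1 : ℕ) := by
        push_cast at h ⊢
        exact mul_left_cancel₀ hs.ne' (by linarith)
      exact Nat.eq_one_of_mul_eq_one_left (Nat.cast_injective h')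
    -- At `β` the ratio of `G` to `F` in row 2 is now `1 / √m`, so it is `√m` on the other class:
    -- the quiddity of `T'`.
    have hquid : ∀ x, quiddity T x = quiddity T' x := by
      intro x
      have h := halt x.val β.val
      rw [hG.two, hG.two, hF.two, hF.two, hq, hq, hqT β, hβ, hβ1] at h
      by_cases hx : (x.val : ℤ) ≡ β.val [ZMOD 2]
      · have h := h.1 hx
        rw [hsame x hx]
        refine mul_left_cancel₀ hs.ne' ?_
        push_cast at h
        linarith
      · have h := h.2 hx
        rw [hdiff x hx, ← hss]
        push_cast at h
        linarith
    refine ⟨β.val, fun k h1 h2 hk i => ?_⟩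
    rw [hF.eq_of_quiddity hF' (fun _ => rfl) k (by omega) i,
      hG.eq_of_quiddity hG' hquid k (by omega) i]
    exact heven k h1 h2 hk i
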